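/- Let $\Sigma$ be a finite alphabet. A factor of an infinite word $\mathbf{x}\in\Sigma^{\mathbb N}$ is a finite (possibly empty) block of consecutive letters of $\mathbf{x}$; let $\mathcal{L}(\mathbf{x})$ be the set of all factors of $\mathbf{x}$, and let $|v|$ denote the length of a finite word $v$ and $|v|_a$ the number of occurrences of the letter $a$ in $v$. The word $\mathbf{x}$ is *aperiodic* if it is not ultimately periodic, *recurrent* if each of its factors occurs in it infinitely many times, and *balanced* if $\bigl||v|_a-|v'|_a\bigr|\le 1$ for all $v,v'\in\mathcal{L}(\mathbf{x})$ with $|v|=|v'|$ and all $a\in\Sigma$. The *abelian closure* of $\mathbf{x}$ is $$\mathcal{A}(\mathbf{x})=\{\mathbf{y}\in\Sigma^{\mathbb N} : \forall v\in\mathcal{L}(\mathbf{y})\ \exists w\in\mathcal{L}(\mathbf{x})\ \forall a\in\Sigma,\ |v|_a=|w|_a\}.$$ A *subshift* is a non-empty set $X\subseteq\Sigma^{\mathbb N}$ that is closed in the product topology (with $\Sigma$ discrete) and satisfies $\sigma(X)\subseteq X$, where $\sigma(a_0a_1a_2\cdots)=a_1a_2\cdots$; it is *minimal* if it contains no subshift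 other than itself. **Theorem.** If $\mathbf{u}\in\Sigma^{\mathbb N}$ is aperiodic, recurrent and balanced, then its abelian closure $\mathcal{A}(\mathbf{u})$ is the union of finitely many minimal subshifts. -/

import Mathlib

open SymbolicDynamics.FullShift

namespace AbelianClosure

/-- The block of length `n` of the infinite word `x` starting at position `i`. -/
def block {A : Type*} (x : ℕ → A) (i n : ℕ) : List A :=
  (List.range n).map (fun j => x (i + j))

/-- The language of `x`: the set of its (finite, possibly empty) factors. -/
def language {A : Type*} (x : ℕ → A) : Set (List A) :=
  {w | ∃ i n : ℕ, w = block x i n}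

/-- Each factor of `x` occurs at infinitely many positions. -/
def IsRecurrent {A : Type*} (x : ℕ → A) : Prop :=
  ∀ w ∈ language x, {i : ℕ | block x i w.length = w}.Infinite

/-- `x` is not ultimately periodic. -/
def IsAperiodic {A : Type*} (x : ℕ → A) : Prop :=
  ¬ ∃ p N : ℕ, 0 < p ∧ ∀ n : ℕ, N ≤ n → x (n + p) = x n

/-- For any two factors of `x` of the same length and any letter `a`, the numbers of occurrences
of `a` in them differ by at most one. -/
def IsBalanced {A : Type*} [DecidableEq A] (x : ℕ → A) : Prop :=
  ∀ v ∈ language x, ∀ w ∈ language x, v.length = w.length →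
    ∀ a : A, |(v.count a : ℤ) - (w.count a : ℤ)| ≤ 1

/-- Two finite words are abelian equivalent if each letter occurs equally often in both. -/
def AbEquiv {A : Type*} [DecidableEq A] (v w : List A) : Prop :=
  ∀ a : A, v.count a = w.count a

/-- The abelian closure of `x`. -/
def abClosure {A : Type*} [DecidableEq A] (x : ℕ → A) : Set (ℕ → A) :=
  {y | ∀ v ∈ language y, ∃ w ∈ language x, AbEquiv v w}

/-- A subshift of `ℕ → A` is minimal if it is non-empty and contains no other non-empty
subshift. (Mathlib's `Subshift` allows the empty set.) -/
def IsMinimalSubshift {A : Type*} [TopologicalSpace A] (X : Subshift A ℕ) : Prop :=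
  X.carrier.Nonempty ∧
    ∀ Y : Subshift A ℕ, Y.carrier.Nonempty → Y.carrier ⊆ X.carrier → Y.carrier = X.carrier

end AbelianClosure

/-! ### Rotations of the circle: density, simultaneous returns, and separation by second moments. -/

namespace AbelianClosure

open Filter Topology

/-! Balance gives each letter `a` a frequency `α a`, the same for all words of the abelian closure.
The `height` of `a` at `n` measures how far the discrepancy of `a` lies below its supremum. It stays
in [0, 1]; modulo 1 it is an orbit of the rotation by `α a`, and it drops by an extra 1 exactly when
`a` is read. So every letter is coded by a rotation, up to ambiguity at the endpoints, and the
heights of all letters have constant sum.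

The key is rigidity (`commensurable_and_zsmul_height_eq`). Aperiodicity makes some `α a` irrational.
Let C be the letters commensurable with `a` and in phase with it. Return times of the rotation by `α
a` that keep the other letters away from their endpoints show that, for a suitable m, the number of
letters of C in a window of length m is eventually constant (`exists_sum_occ_eq`). Membership in C
is then eventually m-periodic; since `a` occurs in every tail of every residue class modulo m,
eventually all letters lie in C. Hence a single rotation drives every letter of nonzero frequency:
the multiples `p b • height b` agree on the circle.

Consequently two words sharing a long enough factor differ by one real phase, which a shift makes
arbitrarily small with either sign; one of the signs reproduces any given factor
(`exists_forall_factor_of_common_factor`). So a common factor of a uniform length N forces equal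
languages. There are finitely many words of length N, hence finitely many languages, and each of
them defines a minimal subshift. -/

theorem exists_nat_forall_exists_nsmul_near {x : UnitAddCircle} (hx : ¬ IsOfFinAddOrder x)
    {η : ℝ} (hη : 0 < η) : ∃ N : ℕ, ∀ z : UnitAddCircle, ∃ n < N, ‖n • x - z‖ < η := by
  have hd : DenseRange (fun k : ℤ => k • x) := by
    rw [AddCircle.denseRange_zsmul_iff, addOrderOf_eq_zero_iff]; exact hx
  obtain ⟨t, ht⟩ := isCompact_univ.elim_finite_subcover
    (fun k : ℤ => Metric.ball (k • x) η) (fun _ => Metric.isOpen_ball) (by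
      intro z _
      obtain ⟨k, hk⟩ := hd.exists_dist_lt z hη
      exact Set.mem_iUnion.2 ⟨k, hk⟩)
  obtain ⟨M, hM⟩ : ∃ M : ℕ, ∀ k ∈ t, k.natAbs ≤ M := ⟨t.sup Int.natAbs, fun k hk =>
    Finset.le_sup (f := Int.natAbs) hk⟩
  refine ⟨2 * M + 1, fun z => ?_⟩
  have := ht (Set.mem_univ (z - M • x))
  simp only [Set.mem_iUnion] at this
  obtain ⟨k, hk, hz⟩ := this
  have := hM k hk
  refine ⟨(k + M).toNat, by omega, ?_⟩
  have e : ((k + M).toNat : ℤ) = k + M := Int.toNat_of_nonneg (by omega)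
  rw [Metric.mem_ball, dist_eq_norm, norm_sub_rev] at hz
  rw [← natCast_zsmul, e, add_zsmul, natCast_zsmul]
  rwa [show k • x + M • x - z = k • x - (z - M • x) by abel]

theorem exists_ge_nsmul_near {x : UnitAddCircle} (hx : ¬ IsOfFinAddOrder x) {η : ℝ} (hη : 0 < η)
    (z : UnitAddCircle) (N : ℕ) : ∃ n ≥ N, ‖n • x - z‖ < η := by
  obtain ⟨M, hM⟩ := exists_nat_forall_exists_nsmul_near hx hη
  obtain ⟨n, -, hn⟩ := hM (z - N • x)
  refine ⟨n + N, by omega, ?_⟩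
  rwa [add_nsmul, show n • x + N • x - z = n • x - (z - N • x) by abel]

theorem exists_pos_forall_norm_nsmul_lt {ι : Type*} [Fintype ι] (v : ι → UnitAddCircle) {ε : ℝ}
    (hε : 0 < ε) : ∃ m : ℕ, 0 < m ∧ ∀ b, ‖m • v b‖ < ε := by
  obtain ⟨w, -, φ, hφ, hw⟩ := isCompact_univ.tendsto_subseq
    (x := fun n : ℕ => n • v) (fun _ => Set.mem_univ _)
  obtain ⟨N, hN⟩ := Metric.cauchySeq_iff.1 hw.cauchySeq ε hε
  have h := hN (N + 1) (by omega) N le_rfl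
  have hlt : φ N < φ (N + 1) := hφ (Nat.lt_succ_self N)
  refine ⟨φ (N + 1) - φ N, by omega, fun b => ?_⟩
  have h' := (dist_pi_lt_iff hε).1 h b
  simp only [Function.comp_apply, Pi.smul_apply, dist_eq_norm] at h'
  rwa [sub_nsmul _ hlt.le, ← sub_eq_add_neg]

theorem tendsto_mean_pow {w : ℂ} (hw : ‖w‖ = 1) :
    Tendsto (fun n : ℕ => (n : ℂ)⁻¹ * ∑ t ∈ Finset.range n, w ^ t) atTop
      (𝓝 (if w = 1 then 1 else 0)) := by
  split_ifs with h
  · subst h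
    refine tendsto_const_nhds.congr' ?_
    filter_upwards [eventually_gt_atTop 0] with n hn
    have : (n : ℂ) ≠ 0 := by exact_mod_cast hn.ne'
    simp [this]
  · have h1 : w - 1 ≠ 0 := sub_ne_zero.2 h
    have : Tendsto (fun n : ℕ => (n : ℝ)⁻¹ * (2 / ‖w - 1‖)) atTop (𝓝 0) := by
      simpa using tendsto_inv_atTop_nhds_zero_nat.mul_const (2 / ‖w - 1‖)
    refine squeeze_zero_norm (fun n => ?_) this
    rw [geom_sum_eq h, norm_mul, norm_inv, Complex.norm_natCast, norm_div]
    gcongr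
    calc ‖w ^ n - 1‖ ≤ ‖w ^ n‖ + ‖(1 : ℂ)‖ := norm_sub_le _ _
      _ = 2 := by rw [norm_pow, hw]; norm_num

/-- Expanding the square, each off-diagonal term is a geometric mean in a ratio different from 1 and
vanishes in the limit; each diagonal term contributes 1. -/
theorem tendsto_mean_normSq_sum {σ : Type*} [Fintype σ] {z : σ → ℂ} (hz : ∀ s, ‖z s‖ = 1)
    (hinj : Function.Injective z) :
    Tendsto (fun n : ℕ => (n : ℝ)⁻¹ * ∑ t ∈ Finset.range n, ‖∑ s, z s ^ t‖ ^ 2) atTop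
      (𝓝 (Fintype.card σ)) := by
  classical
  have key : Tendsto (fun n : ℕ => ∑ s, ∑ s', (n : ℂ)⁻¹ *
      ∑ t ∈ Finset.range n, (z s * (starRingEnd ℂ) (z s')) ^ t) atTop
      (𝓝 (∑ s : σ, ∑ s' : σ, if s = s' then 1 else 0)) := by
    refine tendsto_finsetSum _ fun s _ => tendsto_finsetSum _ fun s' _ => ?_
    have e : (z s * (starRingEnd ℂ) (z s') = 1) = (s = s') := by
      have h1 : z s' * (starRingEnd ℂ) (z s') = 1 := by
        rw [Complex.mul_conj, Complex.normSq_eq_norm_sq, hz]; norm_num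
      have h0 : (starRingEnd ℂ) (z s') ≠ 0 := by
        intro h; rw [h, mul_zero] at h1; exact zero_ne_one h1
      rw [← hinj.eq_iff (a := s), ← h1, mul_left_inj' h0]
    have := tendsto_mean_pow (w := z s * (starRingEnd ℂ) (z s')) (by simp [hz])
    simpa only [e] using this
  have hre := (Complex.continuous_re.tendsto _).comp key
  have hlim : (∑ s : σ, ∑ s' : σ, if s = s' then (1 : ℂ) else 0).re = Fintype.card σ := by
    simp
  rw [hlim] at hre
  refine hre.congr fun n => ?_
  simp only [Function.comp_apply]
  have : (∑ s, ∑ s', (n : ℂ)⁻¹ * ∑ t ∈ Finset.range n, (z s * (starRingEnd ℂ) (z s')) ^ t)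
      = (((n : ℝ)⁻¹ * ∑ t ∈ Finset.range n, ‖∑ s, z s ^ t‖ ^ 2 : ℝ) : ℂ) := by
    push_cast
    have e : ∀ t, ((‖∑ s, z s ^ t‖ : ℝ) : ℂ) ^ 2
        = ∑ s, ∑ s', (z s * (starRingEnd ℂ) (z s')) ^ t := by
      intro t
      rw [← Complex.mul_conj', map_sum, Finset.sum_mul_sum]
      simp only [map_pow, mul_pow]
    simp only [e, ← Finset.mul_sum]
    rw [Finset.sum_comm (s := Finset.range n)]
    congr 1
    exact Finset.sum_congr rfl fun s _ => Finset.sum_comm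
  rw [this, Complex.ofReal_re]

theorem norm_pow_sub_one_le {z : ℂ} (hz : ‖z‖ = 1) (l : ℕ) : ‖z ^ l - 1‖ ≤ l * ‖z - 1‖ := by
  induction l with
  | zero => simp
  | succ l ih =>
    calc ‖z ^ (l + 1) - 1‖ = ‖z ^ l * (z - 1) + (z ^ l - 1)‖ := by congr 1; ring
      _ ≤ ‖z ^ l * (z - 1)‖ + ‖z ^ l - 1‖ := norm_add_le _ _
      _ ≤ ‖z - 1‖ + l * ‖z - 1‖ := by rw [norm_mul, norm_pow, hz]; gcongr; simp
      _ = _ := by push_cast; ring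

/-- A second-moment argument. `F` has mean K, and `G i`, which is `F` times the squared geometric
sum in `ξ i ^ t`, has mean K * L. If every t with `ζ ^ t` near 1 had some `ξ i ^ t` near 1, then `F`
would be at most (4 / L²) ∑ `G i` there and at most 4 / δ² elsewhere; comparing means contradicts
the size of K. Only independence of each `ξ i` from `ζ` matters, not of the `ξ i` among themselves.
-/
theorem exists_pow_near_one_and_far {ι : Type*} [Fintype ι] {ζ : ℂ} {ξ : ι → ℂ} (hζ : ‖ζ‖ = 1)
    (hξ : ∀ i, ‖ξ i‖ = 1) (hζ' : Function.Injective fun k : ℕ => ζ ^ k)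
    (hinj : ∀ i, Function.Injective fun q : ℕ × ℕ => ζ ^ q.1 * ξ i ^ q.2) :
    ∃ η > 0, ∀ δ > 0, ∃ t : ℕ, ‖ζ ^ t - 1‖ < δ ∧ ∀ i, η ≤ ‖ξ i ^ t - 1‖ := by
  -- With this L the terms `G i` cost a proportion 4 * card ι / L ≤ 1 / 2 of the mean of `F`.
  set L : ℕ := 8 * Fintype.card ι + 8 with hL
  have hL0 : (0 : ℝ) < L := by positivity
  refine ⟨1 / (2 * L), by positivity, fun δ hδ => ?_⟩
  by_contra! hcon
  obtain ⟨K, hK⟩ := exists_nat_gt (8 / δ ^ 2)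
  let F : ℕ → ℝ := fun t => ‖∑ k : Fin K, (ζ ^ (k : ℕ)) ^ t‖ ^ 2
  let G : ι → ℕ → ℝ := fun i t => ‖∑ q : Fin K × Fin L, (ζ ^ (q.1 : ℕ) * ξ i ^ (q.2 : ℕ)) ^ t‖ ^ 2
  have hF := tendsto_mean_normSq_sum (z := fun k : Fin K => ζ ^ (k : ℕ)) (by simp [hζ])
    (fun k k' h => Fin.ext (hζ' h))
  have hG := fun i => tendsto_mean_normSq_sum
    (z := fun q : Fin K × Fin L => ζ ^ (q.1 : ℕ) * ξ i ^ (q.2 : ℕ)) (by simp [hζ, hξ])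
    (fun q q' h => by
      have := hinj i (a₁ := (q.1, q.2)) (a₂ := (q'.1, q'.2)) h
      simp only [Prod.mk.injEq] at this
      exact Prod.ext (Fin.ext this.1) (Fin.ext this.2))
  have hmean := hF.sub ((tendsto_finsetSum Finset.univ fun i _ => hG i).const_mul (4 / (L : ℝ) ^ 2))
  have hGF : ∀ i t, G i t = F t * ‖∑ l : Fin L, (ξ i ^ t) ^ (l : ℕ)‖ ^ 2 := by
    intro i t
    simp only [G, F]
    rw [← mul_pow, ← norm_mul, Finset.sum_mul_sum, Fintype.sum_prod_type]
    simp_rw [mul_pow, ← pow_mul, mul_comm t]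
  have hbound : ∀ t, F t - 4 / (L : ℝ) ^ 2 * ∑ i, G i t ≤ 4 / δ ^ 2 := by
    intro t
    have hF0 : 0 ≤ F t := by positivity
    have hG0 : ∀ i, 0 ≤ G i t := fun i => by positivity
    by_cases ht : ‖ζ ^ t - 1‖ < δ
    · obtain ⟨i, hi⟩ := hcon t ht
      have h1 : (L : ℝ) / 2 ≤ ‖∑ l : Fin L, (ξ i ^ t) ^ (l : ℕ)‖ := by
        have hx1 : ‖ξ i ^ t‖ = 1 := by simp [hξ]
        have e : ∑ l : Fin L, (ξ i ^ t) ^ (l : ℕ) = L + ∑ l : Fin L, ((ξ i ^ t) ^ (l : ℕ) - 1) := by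
          rw [Finset.sum_sub_distrib]; simp
        have h2 : ‖∑ l : Fin L, ((ξ i ^ t) ^ (l : ℕ) - 1)‖ ≤ L / 2 := by
          calc _ ≤ ∑ l : Fin L, ‖(ξ i ^ t) ^ (l : ℕ) - 1‖ := norm_sum_le _ _
            _ ≤ ∑ l : Fin L, (1 / 2 : ℝ) := by
              refine Finset.sum_le_sum fun l _ => ?_
              calc _ ≤ (l : ℕ) * ‖ξ i ^ t - 1‖ := norm_pow_sub_one_le hx1 _
                _ ≤ L * (1 / (2 * L)) := by
                  gcongr
                  exact l.2.le
                _ = 1 / 2 := by field_simp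
            _ = L / 2 := by simp; ring
        rw [e]
        have h3 := norm_sub_le ((L : ℂ) + ∑ l : Fin L, ((ξ i ^ t) ^ (l : ℕ) - 1))
          (∑ l : Fin L, ((ξ i ^ t) ^ (l : ℕ) - 1))
        rw [add_sub_cancel_right, Complex.norm_natCast] at h3
        linarith
      have h2 : F t ≤ 4 / (L : ℝ) ^ 2 * G i t := by
        rw [hGF]
        have : ((L : ℝ) / 2) ^ 2 ≤ ‖∑ l : Fin L, (ξ i ^ t) ^ (l : ℕ)‖ ^ 2 := by gcongr
        calc F t = 4 / (L : ℝ) ^ 2 * (F t * ((L : ℝ) / 2) ^ 2) := by field_simp; norm_num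
          _ ≤ _ := by gcongr
      have h3 : G i t ≤ ∑ i, G i t :=
        Finset.single_le_sum (f := fun i => G i t) (fun i _ => hG0 i) (Finset.mem_univ i)
      have h4 : 4 / (L : ℝ) ^ 2 * G i t ≤ 4 / (L : ℝ) ^ 2 * ∑ i, G i t := by gcongr
      have : (0 : ℝ) ≤ 4 / δ ^ 2 := by positivity
      linarith
    · push Not at ht
      have h0 : 0 ≤ 4 / (L : ℝ) ^ 2 * ∑ i, G i t :=
        mul_nonneg (by positivity) (Finset.sum_nonneg fun i _ => hG0 i)
      have h1 : ‖∑ k : Fin K, (ζ ^ (k : ℕ)) ^ t‖ ≤ 2 / δ := by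
        have hne : ζ ^ t ≠ 1 := by
          intro h; rw [h] at ht; simp at ht; linarith
        have e : ∑ k : Fin K, (ζ ^ (k : ℕ)) ^ t = ((ζ ^ t) ^ K - 1) / (ζ ^ t - 1) := by
          rw [← geom_sum_eq hne, ← Fin.sum_univ_eq_sum_range]
          exact Finset.sum_congr rfl fun k _ => pow_right_comm _ _ _
        rw [e, norm_div]
        gcongr
        calc _ ≤ ‖(ζ ^ t) ^ K‖ + ‖(1 : ℂ)‖ := norm_sub_le _ _
          _ = 2 := by simp [hζ]; norm_num
      have h2 : F t ≤ 4 / δ ^ 2 := by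
        calc F t ≤ (2 / δ) ^ 2 := by simp only [F]; gcongr
          _ = _ := by ring
      linarith
  have hle := le_of_tendsto hmean (b := 4 / δ ^ 2) (by
    filter_upwards [eventually_gt_atTop 0] with n hn
    have hn' : (0 : ℝ) < n := by exact_mod_cast hn
    calc _ = (n : ℝ)⁻¹ * ∑ t ∈ Finset.range n, (F t - 4 / (L : ℝ) ^ 2 * ∑ i, G i t) := by
          rw [Finset.sum_sub_distrib, ← Finset.mul_sum, ← Finset.mul_sum, Finset.sum_comm]
          simp only [F, G]; ring
      _ ≤ (n : ℝ)⁻¹ * ∑ t ∈ Finset.range n, (4 / δ ^ 2) := by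
          gcongr with t; exact hbound t
      _ = 4 / δ ^ 2 := by simp; field_simp)
  simp only [Fintype.card_fin, Fintype.card_prod, Finset.sum_const, Finset.card_univ,
    nsmul_eq_mul] at hle
  have e : (K : ℝ) - 4 / (L : ℝ) ^ 2 * (Fintype.card ι * ((K * L : ℕ) : ℝ))
      = K * (1 - 4 * Fintype.card ι / L) := by
    push_cast; field_simp
  have h1 : 4 * (Fintype.card ι : ℝ) / L ≤ 1 / 2 := by
    rw [div_le_iff₀ hL0, hL]; push_cast; linarith
  have h2 : (K : ℝ) * (1 / 2) ≤ K * (1 - 4 * Fintype.card ι / L) := by gcongr; linarith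
  rw [e] at hle
  have : 8 / δ ^ 2 = 2 * (4 / δ ^ 2) := by ring
  linarith

theorem exists_nsmul_near_zero_and_far {ι : Type*} [Fintype ι] {x : UnitAddCircle}
    {β : ι → UnitAddCircle} (hx : ¬ IsOfFinAddOrder x)
    (hβ : ∀ i (k l : ℤ), k • x + l • β i = 0 → l = 0) :
    ∃ η > 0, ∀ δ > 0, ∃ t : ℕ, ‖t • x‖ < δ ∧ ∀ i, η ≤ ‖t • β i‖ := by
  have hx' : ∀ k : ℤ, k • x = 0 → k = 0 := by
    intro k hk
    by_contra h
    exact hx (isOfFinAddOrder_iff_zsmul_eq_zero.2 ⟨k, h, hk⟩)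
  have hinj := AddCircle.injective_toCircle (T := (1 : ℝ)) one_ne_zero
  obtain ⟨η, hη, H⟩ := exists_pow_near_one_and_far (ζ := (AddCircle.toCircle x : ℂ))
    (ξ := fun i => (AddCircle.toCircle (β i) : ℂ)) (Circle.norm_coe _) (fun _ => Circle.norm_coe _)
    (by
      intro k k' h
      simp only [← Circle.coe_pow, ← AddCircle.toCircle_nsmul] at h
      have h := hinj (Circle.ext h)
      have := hx' (k - k') (by rw [sub_zsmul, natCast_zsmul, natCast_zsmul, h, add_neg_cancel])
      omega)
    (by
      rintro i ⟨k, l⟩ ⟨k', l'⟩ h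
      simp only [← Circle.coe_pow, ← AddCircle.toCircle_nsmul, ← Circle.coe_mul,
        ← AddCircle.toCircle_add] at h
      have h := hinj (Circle.ext h)
      have e : ((k : ℤ) - k') • x + ((l : ℤ) - l') • β i = 0 := by
        simp only [sub_zsmul, natCast_zsmul]
        rw [← sub_eq_zero] at h
        rw [← h]; abel
      have hl := hβ i _ _ e
      rw [hl, zero_zsmul, add_zero] at e
      have := hx' _ e
      ext <;> simp <;> omega)
  have hc : ContinuousAt (fun y : UnitAddCircle => (AddCircle.toCircle y : ℂ)) 0 :=
    (continuous_subtype_val.comp (AddCircle.continuous_toCircle)).continuousAt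
  obtain ⟨η', hη', Hη⟩ := Metric.continuousAt_iff.1 hc η hη
  refine ⟨η', hη', fun δ hδ => ?_⟩
  have hemb : IsClosedEmbedding (fun y : UnitAddCircle => (AddCircle.toCircle y : ℂ)) :=
    (continuous_subtype_val.comp AddCircle.continuous_toCircle).isClosedEmbedding
      fun _ _ h => hinj (Circle.ext h)
  have hmem := hemb.isInducing.nhds_eq_comap 0 ▸ Metric.ball_mem_nhds (0 : UnitAddCircle) hδ
  obtain ⟨U, hU, hUδ⟩ := hmem
  obtain ⟨δ', hδ', hball⟩ := Metric.mem_nhds_iff.1 hU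
  obtain ⟨t, ht, ht'⟩ := H δ' hδ'
  refine ⟨t, ?_, fun i => ?_⟩
  · have := @hUδ (t • x) (hball (by
      rw [Metric.mem_ball, dist_eq_norm, AddCircle.toCircle_zero]
      change ‖((AddCircle.toCircle (t • x) : Circle) : ℂ) - 1‖ < δ'
      rw [AddCircle.toCircle_nsmul]
      exact ht))
    simpa using this
  · by_contra! hlt
    have := Hη (x := t • β i) (by simpa using hlt)
    rw [dist_eq_norm, AddCircle.toCircle_nsmul] at this
    rw [AddCircle.toCircle_zero] at this
    exact absurd (ht' i) (not_le.2 this)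

end AbelianClosure

/-! ### Letter counts, frequencies and heights of balanced words. -/

namespace AbelianClosure

open Filter Topology

variable {A : Type*} [DecidableEq A]

/-- The number of occurrences of `a` in the block of length `n` at position `i`. -/
def occ (y : ℕ → A) (a : A) (i n : ℕ) : ℤ := ((block y i n).count a : ℤ)

theorem length_block {B : Type*} (y : ℕ → B) (i n : ℕ) : (block y i n).length = n := by
  simp [block]

theorem block_eq_iff {B : Type*} {y z : ℕ → B} {i j n : ℕ} :
    block y i n = block z j n ↔ ∀ q < n, y (i + q) = z (j + q) := by
  simp [block, List.map_inj_left]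

theorem occ_zero (y : ℕ → A) (a : A) (i : ℕ) : occ y a i 0 = 0 := by simp [occ, block]

theorem occ_succ (y : ℕ → A) (a : A) (i n : ℕ) :
    occ y a i (n + 1) = occ y a i n + if y (i + n) = a then 1 else 0 := by
  simp [occ, block, List.range_succ, List.count_singleton]

theorem occ_add (y : ℕ → A) (a : A) (i n m : ℕ) :
    occ y a i (n + m) = occ y a i n + occ y a (i + n) m := by
  induction m with
  | zero => simp [occ_zero]
  | succ m ih => rw [← add_assoc, occ_succ, ih, occ_succ, add_assoc, add_assoc]

theorem occ_one (y : ℕ → A) (a : A) (i : ℕ) : occ y a i 1 = if y i = a then 1 else 0 := by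
  rw [occ_succ, occ_zero]; simp

theorem occ_nonneg (y : ℕ → A) (a : A) (i n : ℕ) : 0 ≤ occ y a i n := by simp [occ]

theorem occ_shift (y : ℕ → A) (a : A) (i n : ℕ) :
    occ y a (i + 1) n = occ y a i n + (if y (i + n) = a then 1 else 0) -
      if y i = a then 1 else 0 := by
  have h1 := occ_succ y a i n
  have h2 := occ_add y a i 1 n
  rw [occ_one, add_comm 1 n] at h2
  linarith

theorem occ_congr {y z : ℕ → A} {i j n : ℕ} (h : ∀ q < n, y (i + q) = z (j + q)) (a : A) :
    occ y a i n = occ z a j n := by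
  rw [occ, occ, block_eq_iff.2 h]

theorem occ_eq_zero {y : ℕ → A} {a : A} (h : ∀ n, y n ≠ a) (i n : ℕ) : occ y a i n = 0 := by
  induction n with
  | zero => exact occ_zero y a i
  | succ n ih => rw [occ_succ, ih, if_neg (h _), add_zero]

theorem sum_occ [Fintype A] (y : ℕ → A) (i n : ℕ) : ∑ a, occ y a i n = n := by
  induction n with
  | zero => simp [occ_zero]
  | succ n ih => simp [occ_succ, Finset.sum_add_distrib, ih]

/-- Every letter `a` has frequency `α a` in `y`, with balanced counts, and letters of frequency
zero do not occur. -/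
structure IsBalancedWith (α : A → ℝ) (y : ℕ → A) : Prop where
  abs_occ_sub_le : ∀ a i n, |(occ y a i n : ℝ) - n * α a| ≤ 1
  abs_occ_sub_occ_le : ∀ a i j n, |occ y a i n - occ y a j n| ≤ 1
  ne_of_eq_zero : ∀ a, α a = 0 → ∀ n, y n ≠ a

theorem abs_occ_sub_occ_le_of_isBalanced {u : ℕ → A} (hu : IsBalanced u) (a : A) (i j n : ℕ) :
    |occ u a i n - occ u a j n| ≤ 1 :=
  hu _ ⟨i, n, rfl⟩ _ ⟨j, n, rfl⟩ (by simp [length_block]) a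

/-- Cutting a prefix of length n * k into blocks of length n, or of length k, shows that the
averages over lengths n and k differ by at most 1 / n + 1 / k; so prefix averages are Cauchy. -/
theorem exists_slope_of_isBalanced {u : ℕ → A} (hu : IsBalanced u) (a : A) :
    ∃ α : ℝ, ∀ i n, |(occ u a i n : ℝ) - n * α| ≤ 1 := by
  have hb := fun i j n => abs_le.1 (abs_occ_sub_occ_le_of_isBalanced hu a i j n)
  have hmul : ∀ i n k : ℕ, |(occ u a 0 (n * k) : ℝ) - k * occ u a i n| ≤ k := by
    intro i n k
    induction k with
    | zero => simp [occ_zero]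
    | succ k ih =>
      have e := occ_add u a 0 (n * k) n
      have h := hb (0 + n * k) i n
      rw [mul_add, mul_one, e]
      have h1 : ((-1 : ℤ) : ℝ) ≤ (occ u a (0 + n * k) n - occ u a i n : ℤ) := by exact_mod_cast h.1
      have h2 : ((occ u a (0 + n * k) n - occ u a i n : ℤ) : ℝ) ≤ (1 : ℤ) := by exact_mod_cast h.2
      push_cast at h1 h2 ⊢
      rw [abs_le] at ih ⊢
      constructor <;> linarith [ih.1, ih.2]
  have hcomp : ∀ i n k : ℕ, 0 < n → 0 < k →
      |(occ u a i n : ℝ) / n - occ u a 0 k / k| ≤ 1 / n + 1 / k := by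
    intro i n k hn hk
    have h1 := abs_le.1 (hmul i n k)
    have h2 := abs_le.1 (hmul 0 k n)
    rw [mul_comm k n] at h2
    have hn' : (0 : ℝ) < n := by exact_mod_cast hn
    have hk' : (0 : ℝ) < k := by exact_mod_cast hk
    rw [div_sub_div _ _ hn'.ne' hk'.ne', div_add_div _ _ hn'.ne' hk'.ne', abs_div,
      abs_of_pos (mul_pos hn' hk')]
    gcongr
    rw [abs_le]
    constructor <;> linarith [h1.1, h1.2, h2.1, h2.2]
  have hcauchy : CauchySeq fun k : ℕ => (occ u a 0 (k + 1) : ℝ) / (k + 1 : ℕ) := by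
    refine Metric.cauchySeq_iff'.2 fun ε hε => ?_
    obtain ⟨N, hN⟩ := exists_nat_gt (2 / ε)
    have hN1 : (0 : ℝ) < N + 1 := by positivity
    refine ⟨N, fun n hn => ?_⟩
    rw [Real.dist_eq]
    refine (hcomp 0 (n + 1) (N + 1) (by omega) (by omega)).trans_lt ?_
    have h1 : (1 : ℝ) / (n + 1 : ℕ) ≤ 1 / (N + 1 : ℕ) := by gcongr
    have h2 : (1 : ℝ) / (N + 1 : ℕ) < ε / 2 := by
      rw [div_lt_iff₀ (by positivity)] at hN ⊢
      push_cast
      linarith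
    linarith
  obtain ⟨α, hα⟩ := cauchySeq_tendsto_of_complete hcauchy
  refine ⟨α, fun i n => ?_⟩
  rcases Nat.eq_zero_or_pos n with rfl | hn
  · simp [occ_zero]
  have hn' : (0 : ℝ) < n := by exact_mod_cast hn
  have hlim : |(occ u a i n : ℝ) / n - α| ≤ 1 / n + 0 := by
    refine le_of_tendsto_of_tendsto (tendsto_const_nhds.sub hα).abs
      (tendsto_const_nhds.add (tendsto_one_div_add_atTop_nhds_zero_nat (𝕜 := ℝ))) ?_
    exact Eventually.of_forall fun k => by simpa using hcomp i n (k + 1) hn (by omega)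
  have e : (occ u a i n : ℝ) - n * α = n * ((occ u a i n : ℝ) / n - α) := by field_simp
  rw [e, abs_mul, abs_of_pos hn']
  calc _ ≤ (n : ℝ) * (1 / n + 0) := by gcongr
    _ = 1 := by field_simp; ring

theorem exists_isBalancedWith {u : ℕ → A} (hu : IsBalanced u) (hrec : IsRecurrent u) :
    ∃ α, IsBalancedWith α u := by
  choose α hα using exists_slope_of_isBalanced hu
  refine ⟨α, hα, abs_occ_sub_occ_le_of_isBalanced hu, fun a ha n hn => ?_⟩
  -- A letter of frequency zero that occurs would recur; a window with two occurrences has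
  -- discrepancy at least 2.
  have hinf := hrec [a] ⟨n, 1, by simp [block, hn]⟩
  obtain ⟨i, hi⟩ := hinf.nonempty
  obtain ⟨j, hj, hij⟩ := hinf.exists_gt i
  obtain ⟨k, rfl⟩ := Nat.exists_eq_add_of_lt hij
  simp only [block, List.length_singleton, Set.mem_ofPred_eq] at hi hj
  simp at hi hj
  have h := hα a i (1 + (k + 1))
  rw [occ_add, occ_one, occ_succ, hi, if_pos rfl, if_pos (by rw [← hj]; congr 1; omega), ha] at h
  have h0 : (0 : ℝ) ≤ occ u a (i + 1) k := by exact_mod_cast occ_nonneg u a (i + 1) k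
  push_cast at h
  have := (abs_le.1 h).2
  linarith

theorem exists_occ_eq_of_mem_abClosure {u y : ℕ → A} (hy : y ∈ abClosure u) (i n : ℕ) :
    ∃ j, ∀ a, occ y a i n = occ u a j n := by
  obtain ⟨w, ⟨j, m, rfl⟩, h⟩ := hy _ ⟨i, n, rfl⟩
  have hl := (List.perm_iff_count.2 h).length_eq
  rw [length_block, length_block] at hl
  subst hl
  exact ⟨j, fun a => by rw [occ, occ, h a]⟩

theorem IsBalancedWith.of_mem_abClosure {α : A → ℝ} {u y : ℕ → A} (hu : IsBalancedWith α u)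
    (hy : y ∈ abClosure u) : IsBalancedWith α y where
  abs_occ_sub_le a i n := by
    obtain ⟨j, hj⟩ := exists_occ_eq_of_mem_abClosure hy i n
    rw [hj]; exact hu.abs_occ_sub_le a j n
  abs_occ_sub_occ_le a i i' n := by
    obtain ⟨j, hj⟩ := exists_occ_eq_of_mem_abClosure hy i n
    obtain ⟨j', hj'⟩ := exists_occ_eq_of_mem_abClosure hy i' n
    rw [hj, hj']; exact hu.abs_occ_sub_occ_le a j j' n
  ne_of_eq_zero a ha n hn := by
    obtain ⟨j, hj⟩ := exists_occ_eq_of_mem_abClosure hy n 1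
    have := hj a
    rw [occ_eq_zero (hu.ne_of_eq_zero a ha), occ_one, if_pos hn] at this
    exact one_ne_zero this

/-- The distance of the discrepancy of `a` at `n` from its supremum. -/
noncomputable def height (α : A → ℝ) (y : ℕ → A) (a : A) (n : ℕ) : ℝ :=
  (⨆ m : ℕ, ((occ y a 0 m : ℝ) - m * α a)) - (occ y a 0 n - n * α a)

theorem height_add (α : A → ℝ) (y : ℕ → A) (a : A) (n m : ℕ) :
    height α y a (n + m) = height α y a n + m * α a - occ y a n m := by
  simp only [height, occ_add y a 0 n m]
  push_cast
  simp only [zero_add]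
  ring

theorem height_succ (α : A → ℝ) (y : ℕ → A) (a : A) (n : ℕ) :
    height α y a (n + 1) = height α y a n + α a - if y n = a then 1 else 0 := by
  rw [height_add, occ_one]; push_cast; simp

/-- Counts are integers, so on the circle only the rotation by `α a` remains. -/
theorem coe_height_add (α : A → ℝ) (y : ℕ → A) (a : A) (n m : ℕ) :
    (height α y a (n + m) : UnitAddCircle) = height α y a n + m • (α a : UnitAddCircle) := by
  have h : ((occ y a n m : ℝ) : UnitAddCircle) = 0 := by
    rw [AddCircle.coe_eq_zero_iff]; exact ⟨occ y a n m, by simp⟩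
  rw [height_add, AddCircle.coe_sub, AddCircle.coe_add, h, sub_zero, ← nsmul_eq_mul,
    AddCircle.coe_nsmul]

namespace IsBalancedWith

variable {α : A → ℝ} {y : ℕ → A}

theorem bddAbove_range (hy : IsBalancedWith α y) (a : A) :
    BddAbove (Set.range fun m : ℕ => (occ y a 0 m : ℝ) - m * α a) :=
  ⟨1, by rintro _ ⟨m, rfl⟩; exact (abs_le.1 (hy.abs_occ_sub_le a 0 m)).2⟩

theorem height_nonneg (hy : IsBalancedWith α y) (a : A) (n : ℕ) : 0 ≤ height α y a n :=
  sub_nonneg.2 (le_ciSup (hy.bddAbove_range a) n)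

theorem height_le_one (hy : IsBalancedWith α y) (a : A) (n : ℕ) : height α y a n ≤ 1 := by
  rw [height, sub_le_iff_le_add]
  refine ciSup_le fun m => ?_
  rcases le_total m n with h | h
  · obtain ⟨k, rfl⟩ := Nat.exists_eq_add_of_le h
    have := (abs_le.1 (hy.abs_occ_sub_le a (0 + m) k)).1
    rw [occ_add]; push_cast; linarith
  · obtain ⟨k, rfl⟩ := Nat.exists_eq_add_of_le h
    have := (abs_le.1 (hy.abs_occ_sub_le a (0 + n) k)).2
    rw [occ_add]; push_cast; linarith

theorem slope_nonneg (hy : IsBalancedWith α y) (a : A) : 0 ≤ α a := by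
  by_contra! h
  obtain ⟨n, hn⟩ := exists_nat_gt (1 / -α a)
  rw [div_lt_iff₀ (by linarith)] at hn
  have h1 := (abs_le.1 (hy.abs_occ_sub_le a 0 n)).2
  have h0 : (0 : ℝ) ≤ occ y a 0 n := by exact_mod_cast occ_nonneg y a 0 n
  linarith

theorem sum_slope [Fintype A] (hy : IsBalancedWith α y) : ∑ a, α a = 1 := by
  have h : ∀ n : ℕ, (n : ℝ) * |1 - ∑ a, α a| ≤ Fintype.card A := by
    intro n
    have e : (n : ℝ) * (1 - ∑ a, α a) = ∑ a, ((occ y a 0 n : ℝ) - n * α a) := by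
      rw [Finset.sum_sub_distrib, ← Finset.mul_sum, ← Int.cast_sum, sum_occ]; push_cast; ring
    rw [← Nat.abs_cast n, ← abs_mul, e]
    calc _ ≤ ∑ a, |(occ y a 0 n : ℝ) - n * α a| := Finset.abs_sum_le_sum_abs _ _
      _ ≤ ∑ a : A, (1 : ℝ) := Finset.sum_le_sum fun a _ => hy.abs_occ_sub_le a 0 n
      _ = _ := by simp
  by_contra hne
  have hpos : 0 < |1 - ∑ a, α a| := abs_pos.2 (sub_ne_zero.2 (Ne.symm hne))
  obtain ⟨n, hn⟩ := exists_nat_gt (Fintype.card A / |1 - ∑ a, α a|)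
  rw [div_lt_iff₀ hpos] at hn
  linarith [h n]

theorem slope_le_one [Fintype A] (hy : IsBalancedWith α y) (a : A) : α a ≤ 1 := by
  rw [← hy.sum_slope]
  exact Finset.single_le_sum (fun b _ => hy.slope_nonneg b) (Finset.mem_univ a)

theorem sum_height [Fintype A] (hy : IsBalancedWith α y) (n : ℕ) :
    ∑ a, height α y a n = ∑ a, height α y a 0 := by
  have h : ∀ a, height α y a n = height α y a 0 + n * α a - occ y a 0 n := fun a => by
    rw [← height_add, zero_add]
  simp only [h, Finset.sum_sub_distrib, Finset.sum_add_distrib, ← Finset.mul_sum]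
  rw [hy.sum_slope, ← Int.cast_sum, sum_occ]
  simp

theorem height_of_slope_eq_zero (hy : IsBalancedWith α y) {a : A} (ha : α a = 0) (n : ℕ) :
    height α y a n = height α y a 0 := by
  have := height_add α y a 0 n
  rw [zero_add, ha, occ_eq_zero (hy.ne_of_eq_zero a ha)] at this
  simpa using this

theorem eq_of_lt_height (hy : IsBalancedWith α y) {a : A} {n : ℕ} (h : 1 - α a < height α y a n) :
    y n = a := by
  by_contra hne
  have h1 := height_succ α y a n
  rw [if_neg hne] at h1
  linarith [hy.height_le_one a (n + 1)]

theorem slope_pos (hy : IsBalancedWith α y) (n : ℕ) : 0 < α (y n) :=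
  (hy.slope_nonneg _).lt_of_ne fun h => hy.ne_of_eq_zero _ h.symm n rfl

theorem height_inj {a : A} (ha : ¬ IsOfFinAddOrder (α a : UnitAddCircle)) {n n' : ℕ}
    (h : (height α y a n : UnitAddCircle) = height α y a n') : n = n' := by
  wlog hle : n ≤ n' generalizing n n'
  · exact (this h.symm (le_of_not_ge hle)).symm
  obtain ⟨k, rfl⟩ := Nat.exists_eq_add_of_le hle
  rw [coe_height_add, left_eq_add] at h
  by_contra hk
  exact ha (isOfFinAddOrder_iff_nsmul_eq_zero.2 ⟨k, by omega, h⟩)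

end IsBalancedWith

/-- Along a residue class modulo m the function descends by integers inside [0, 1], so it can drop
at most once. -/
theorem eventually_eq_zero_of_antitone {h : ℕ → ℝ} {e : ℕ → ℤ} {m : ℕ} (hm : 0 < m)
    (h0 : ∀ n, 0 ≤ h n) (h1 : ∀ n, h n ≤ 1) (he : ∀ n, h (n + m) = h n - e n)
    (hpos : ∀ n, 0 ≤ e n) : ∃ N, ∀ n ≥ N, e n = 0 := by
  have hfin : {n | e n ≠ 0}.Finite := by
    by_contra hinf
    have : NeZero m := ⟨hm.ne'⟩
    obtain ⟨n, hn, n', hn', hne, heq⟩ := Set.Infinite.exists_ne_map_eq_of_mapsTo (t := Set.univ)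
      (f := fun n : ℕ => (n : ZMod m)) hinf (fun _ _ => Set.mem_univ _) Set.finite_univ
    wlog hlt : n < n' generalizing n n'
    · exact this n' hn' n hn hne.symm heq.symm (by omega)
    have hdvd := (Nat.modEq_iff_dvd' hlt.le).1 ((ZMod.natCast_eq_natCast_iff _ _ _).1 heq)
    obtain ⟨k, hk⟩ := hdvd
    obtain ⟨k, rfl⟩ : ∃ j, k = j + 1 := ⟨k - 1, by
      rcases k with _ | k
      · omega
      · omega⟩
    have hanti : ∀ j : ℕ, h (n + m * (j + 1)) ≤ h (n + m) := by
      intro j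
      induction j with
      | zero => simp
      | succ j ih =>
        have e1 := he (n + m * (j + 1))
        have e2 : (0 : ℝ) ≤ e (n + m * (j + 1)) := by exact_mod_cast hpos _
        rw [show n + m * (j + 1 + 1) = n + m * (j + 1) + m by ring]
        linarith
    have hp : ∀ q, e q ≠ 0 → (1 : ℝ) ≤ e q := fun q hq => by
      have h1 : 1 ≤ e q := (hpos q).lt_of_ne hq.symm
      exact_mod_cast h1
    have a1 := hanti k
    rw [← hk, show n + (n' - n) = n' by omega] at a1
    linarith [he n, he n', hp n hn, hp n' hn', h0 (n' + m), h1 n]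
  obtain ⟨N, hN⟩ := hfin.bddAbove
  refine ⟨N + 1, fun n hn => ?_⟩
  by_contra hne
  have := hN hne
  omega

/-- Counts in windows of length m differ by at most one, so their deviations from the integer `m * α
b` all have the same weak sign; the height, or one minus it, is then monotone along residue classes
modulo m. -/
theorem IsBalancedWith.eventually_occ_eq {α : A → ℝ} {y : ℕ → A} (hy : IsBalancedWith α y) {b : A}
    {m : ℕ} (hm : 0 < m) (hb : m • (α b : UnitAddCircle) = 0) :
    ∃ N, ∀ n ≥ N, (occ y b n m : ℝ) = m * α b := by
  rw [← AddCircle.coe_nsmul, AddCircle.coe_eq_zero_iff] at hb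
  obtain ⟨k, hk⟩ := hb
  simp only [zsmul_eq_mul, mul_one, nsmul_eq_mul] at hk
  have hstep : ∀ n, height α y b (n + m) = height α y b n - (occ y b n m - k : ℤ) := fun n => by
    rw [height_add, ← hk]; push_cast; ring
  have hbal := fun i j => abs_le.1 (hy.abs_occ_sub_occ_le b i j m)
  suffices ∃ N, ∀ n ≥ N, occ y b n m - k = 0 by
    obtain ⟨N, hN⟩ := this
    refine ⟨N, fun n hn => ?_⟩
    rw [← hk]
    exact_mod_cast sub_eq_zero.1 (hN n hn)
  by_cases hpos : ∀ n, 0 ≤ occ y b n m - k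
  · exact eventually_eq_zero_of_antitone hm (hy.height_nonneg b) (hy.height_le_one b) hstep hpos
  · push Not at hpos
    obtain ⟨i, hi⟩ := hpos
    obtain ⟨N, hN⟩ := eventually_eq_zero_of_antitone (h := fun n => 1 - height α y b n)
      (e := fun n => -(occ y b n m - k)) hm
      (fun n => by linarith [hy.height_le_one b n]) (fun n => by linarith [hy.height_nonneg b n])
      (fun n => by simp only [hstep]; push_cast; ring)
      (fun n => by have := hbal n i; omega)
    exact ⟨N, fun n hn => neg_eq_zero.1 (hN n hn)⟩

theorem exists_pos_forall_nsmul_eq_zero {ι : Type*} [Fintype ι] (v : ι → UnitAddCircle) :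
    ∃ q : ℕ, 0 < q ∧ ∀ a, IsOfFinAddOrder (v a) → q • v a = 0 := by
  classical
  refine ⟨∏ a, if IsOfFinAddOrder (v a) then addOrderOf (v a) else 1, ?_, fun a ha => ?_⟩
  · refine Finset.prod_pos fun a _ => ?_
    split_ifs with h
    · exact h.addOrderOf_pos
    · exact one_pos
  · rw [← addOrderOf_dvd_iff_nsmul_eq_zero]
    have := Finset.dvd_prod_of_mem (fun a => if IsOfFinAddOrder (v a) then addOrderOf (v a) else 1)
      (Finset.mem_univ a)
    simpa [ha] using this

theorem IsBalancedWith.exists_not_isOfFinAddOrder [Fintype A] {α : A → ℝ} {u : ℕ → A}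
    (hu : IsBalancedWith α u) (haper : IsAperiodic u) :
    ∃ a, ¬ IsOfFinAddOrder (α a : UnitAddCircle) := by
  by_contra! hcon
  obtain ⟨q, hq, hqz⟩ := exists_pos_forall_nsmul_eq_zero fun a => (α a : UnitAddCircle)
  choose N hN using fun a => hu.eventually_occ_eq hq (hqz a (hcon a))
  refine haper ⟨q, Finset.univ.sup N, hq, fun n hn => ?_⟩
  have hle := (Finset.le_sup (f := N) (Finset.mem_univ (u n))).trans hn
  have h := (hN (u n) n hle).trans (hN (u n) (n + 1) (by omega)).symm
  have h' : occ u (u n) n q = occ u (u n) (n + 1) q := by exact_mod_cast h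
  rw [occ_shift, if_pos rfl] at h'
  by_contra hne
  rw [if_neg hne] at h'
  omega

end AbelianClosure

/-! ### Commensurable frequencies and heights near the endpoints. -/

namespace AbelianClosure

open Filter Topology

variable {A : Type*} [DecidableEq A]

theorem norm_coe_le_abs_sub_intCast (x : ℝ) (k : ℤ) : ‖(x : UnitAddCircle)‖ ≤ |x - k| := by
  rw [UnitAddCircle.norm_eq]; exact round_le x k

theorem eventually_lt_nhdsGT_zero {c : ℝ} (hc : 0 < c) : ∀ᶠ γ in 𝓝[>] (0 : ℝ), γ < c :=
  (eventually_lt_nhds hc).filter_mono nhdsWithin_le_nhds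

/-- Two points of the circle are commensurable if they satisfy a linear relation over `ℤ` with
non-zero coefficients. -/
def Commensurable (x y : UnitAddCircle) : Prop :=
  ∃ k l : ℤ, k ≠ 0 ∧ l ≠ 0 ∧ k • x + l • y = 0

theorem Commensurable.refl (x : UnitAddCircle) : Commensurable x x :=
  ⟨1, -1, one_ne_zero, by decide, by simp⟩

theorem Commensurable.not_isOfFinAddOrder {x y : UnitAddCircle} (h : Commensurable x y)
    (hx : ¬ IsOfFinAddOrder x) : ¬ IsOfFinAddOrder y := by
  obtain ⟨k, l, hk, -, h⟩ := h
  intro hy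
  obtain ⟨n, hn, hny⟩ := isOfFinAddOrder_iff_zsmul_eq_zero.1 hy
  refine hx (isOfFinAddOrder_iff_zsmul_eq_zero.2 ⟨n * k, mul_ne_zero hn hk, ?_⟩)
  rw [mul_zsmul, eq_neg_of_add_eq_zero_left h, zsmul_neg, smul_comm, hny, zsmul_zero, neg_zero]

/-- Multiplying each pairwise relation by the coefficients of the others brings all commensurable
points to one common multiple of `v a`. -/
theorem exists_zsmul_eq_zsmul {ι : Type*} [Fintype ι] (v : ι → UnitAddCircle) (a : ι) :
    ∃ p : ι → ℤ, (∀ b, p b ≠ 0) ∧ ∀ b, Commensurable (v a) (v b) → p b • v b = p a • v a := by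
  classical
  have h : ∀ b, ∃ k l : ℤ, k ≠ 0 ∧ l ≠ 0 ∧ (Commensurable (v a) (v b) → k • v a + l • v b = 0) := by
    intro b
    by_cases hb : Commensurable (v a) (v b)
    · obtain ⟨k, l, hk, hl, h⟩ := hb
      exact ⟨k, l, hk, hl, fun _ => h⟩
    · exact ⟨1, 1, one_ne_zero, one_ne_zero, fun h => absurd h hb⟩
  choose k l hk hl h using h
  have key : ∀ b, Commensurable (v a) (v b) →
      (-l b * ∏ c ∈ Finset.univ.erase b, k c) • v b = (∏ c, k c) • v a := by
    intro b hb
    rw [← Finset.mul_prod_erase _ _ (Finset.mem_univ b), mul_comm, mul_comm (k b), mul_zsmul,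
      mul_zsmul, neg_zsmul, ← eq_neg_of_add_eq_zero_left (h b hb)]
  refine ⟨fun b => -l b * ∏ c ∈ Finset.univ.erase b, k c, fun b => ?_, fun b hb => ?_⟩
  · exact mul_ne_zero (neg_ne_zero.2 (hl b)) (Finset.prod_ne_zero_iff.2 fun c _ => hk c)
  · exact (key b hb).trans (key a (Commensurable.refl _)).symm

namespace IsBalancedWith

variable {α : A → ℝ} {y : ℕ → A}

theorem norm_height_le_of_occ_ne (hy : IsBalancedWith α y) {b : A} {n m : ℕ} {k : ℤ} {ε : ℝ}
    (hk : |m * α b - k| < ε) (hne : occ y b n m ≠ k) :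
    ‖(height α y b n : UnitAddCircle)‖ ≤ ε := by
  have h := height_add α y b n m
  have h0 := hy.height_nonneg b n
  have h1 := hy.height_le_one b n
  have h0' := hy.height_nonneg b (n + m)
  have h1' := hy.height_le_one b (n + m)
  rw [abs_lt] at hk
  rcases lt_or_gt_of_ne hne with hlt | hlt
  · have : (occ y b n m : ℝ) ≤ k - 1 := by exact_mod_cast Int.le_sub_one_of_lt hlt
    refine (norm_coe_le_abs_sub_intCast _ 0).trans ?_
    rw [Int.cast_zero, sub_zero, abs_of_nonneg h0]
    linarith
  · have : (k : ℝ) + 1 ≤ occ y b n m := by exact_mod_cast hlt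
    refine (norm_coe_le_abs_sub_intCast _ 1).trans ?_
    rw [Int.cast_one, abs_sub_comm, abs_of_nonneg (by linarith)]
    linarith

theorem occ_eq_of_height_mem (hy : IsBalancedWith α y) {b : A} {n t : ℕ} {k : ℤ} {γ : ℝ}
    (h0 : γ < height α y b n) (h1 : height α y b n < 1 - γ) (hk : |t * α b - k| < γ) :
    occ y b n t = k := by
  have h := height_add α y b n t
  have h0' := hy.height_nonneg b (n + t)
  have h1' := hy.height_le_one b (n + t)
  rw [abs_lt] at hk
  have e1 : (occ y b n t : ℝ) < (k + 1 : ℤ) := by push_cast; linarith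
  have e2 : ((k - 1 : ℤ) : ℝ) < occ y b n t := by push_cast; linarith
  have e1' := Int.cast_lt.1 e1
  have e2' := Int.cast_lt.1 e2
  omega

/-- Away from the endpoints, a window of length t contains exactly the rounded expected number of
`b`. This applies at both n and n + m, so sliding the window of length m by t changes nothing. -/
theorem occ_add_eq_of_height_mem (hy : IsBalancedWith α y) {b : A} {n m t : ℕ} {γ : ℝ}
    (h0 : γ < height α y b n) (h1 : height α y b n < 1 - γ)
    (h0' : γ < height α y b (n + m)) (h1' : height α y b (n + m) < 1 - γ)
    (ht : ‖t • (α b : UnitAddCircle)‖ < γ) : occ y b (n + t) m = occ y b n m := by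
  rw [← AddCircle.coe_nsmul, UnitAddCircle.norm_eq, nsmul_eq_mul] at ht
  have e1 := hy.occ_eq_of_height_mem h0 h1 ht
  have e2 := hy.occ_eq_of_height_mem h0' h1' ht
  have e3 := occ_add y b n t m
  have e4 := occ_add y b n m t
  rw [add_comm t m] at e3
  linarith

theorem coe_height_eq_zero_iff (hy : IsBalancedWith α y) {b : A} {n : ℕ} :
    (height α y b n : UnitAddCircle) = 0 ↔ height α y b n = 0 ∨ height α y b n = 1 := by
  rw [AddCircle.coe_eq_zero_iff]
  constructor
  · rintro ⟨k, hk⟩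
    simp only [zsmul_eq_mul, mul_one] at hk
    have h0 := hy.height_nonneg b n
    have h1 := hy.height_le_one b n
    rw [← hk] at h0 h1 ⊢
    have h0' : 0 ≤ k := by exact_mod_cast h0
    have h1' : k ≤ 1 := by exact_mod_cast h1
    obtain rfl | rfl : k = 0 ∨ k = 1 := by omega
    · simp
    · simp
  · rintro (h | h)
    · exact ⟨0, by simp [h]⟩
    · exact ⟨1, by simp [h]⟩

theorem height_mem_Ioo (hy : IsBalancedWith α y) {b : A} {n : ℕ}
    (h : (height α y b n : UnitAddCircle) ≠ 0) : 0 < height α y b n ∧ height α y b n < 1 := by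
  rw [Ne, hy.coe_height_eq_zero_iff, not_or] at h
  exact ⟨(hy.height_nonneg b n).lt_of_ne' h.1, (hy.height_le_one b n).lt_of_ne h.2⟩

theorem eventually_coe_height_ne_zero {b : A} (hb : ¬ IsOfFinAddOrder (α b : UnitAddCircle)) :
    ∀ᶠ n in atTop, (height α y b n : UnitAddCircle) ≠ 0 := by
  by_cases h : ∃ n, (height α y b n : UnitAddCircle) = 0
  · obtain ⟨n₀, h₀⟩ := h
    filter_upwards [eventually_gt_atTop n₀] with n hn h
    exact hn.ne' (height_inj hb (h.trans h₀.symm))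
  · push Not at h
    exact Eventually.of_forall h

theorem zsmul_height_sub {b c : A} {k l : ℤ}
    (h : k • (α b : UnitAddCircle) = l • (α c : UnitAddCircle)) (n : ℕ) :
    k • (height α y b n : UnitAddCircle) - l • (height α y c n : UnitAddCircle)
      = k • (height α y b 0 : UnitAddCircle) - l • (height α y c 0 : UnitAddCircle) := by
  have hb := coe_height_add α y b 0 n
  have hc := coe_height_add α y c 0 n
  rw [zero_add] at hb hc
  rw [hb, hc, zsmul_add, zsmul_add, smul_comm k n, smul_comm l n, h]
  abel

end IsBalancedWith

end AbelianClosure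

/-! ### Rigidity: all letters of nonzero frequency are in phase. -/

namespace AbelianClosure

open Filter Topology

theorem norm_nsmul_le_of_zsmul_eq_zsmul {x z : UnitAddCircle} {k l : ℤ} {W : ℕ} (hW : 0 < W)
    (hk : k ∣ W) (h : k • z = l • x) (s t : ℕ) :
    ‖(s * W * t) • z‖ ≤ s * W * |(l : ℝ)| * ‖t • x‖ := by
  obtain ⟨w, hw⟩ := hk
  have e : (s * W * t) • z = (s * w * l : ℤ) • (t • x) := by
    rw [← natCast_zsmul, ← natCast_zsmul x t]
    push_cast
    rw [hw, show (s * (k * w) * t : ℤ) = t * (s * w) * k by ring, mul_zsmul, h, smul_smul, smul_smul]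
    congr 1; ring
  have hk0 : k ≠ 0 := by
    rintro rfl; rw [zero_mul] at hw; omega
  have hwW : |w| ≤ W := by
    rw [← Nat.abs_cast W, hw, abs_mul]
    exact le_mul_of_one_le_left (abs_nonneg _) (Int.one_le_abs hk0)
  have hwW' : |(w : ℝ)| ≤ W := by exact_mod_cast hwW
  rw [e]
  refine (norm_zsmul_le _ _).trans ?_
  rw [Int.norm_eq_abs]
  push_cast
  rw [abs_mul, abs_mul, Nat.abs_cast]
  gcongr

variable {A : Type*} [DecidableEq A] [Fintype A] {α : A → ℝ} {y : ℕ → A}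

namespace IsBalancedWith

open scoped Classical in
theorem exists_sum_occ_eq (hy : IsBalancedWith α y) {a : A}
    (ha : ¬ IsOfFinAddOrder (α a : UnitAddCircle)) {p : A → ℤ} (hp0 : ∀ b, p b ≠ 0)
    (hp : ∀ b, Commensurable (α a : UnitAddCircle) (α b) →
      p b • (α b : UnitAddCircle) = p a • (α a : UnitAddCircle)) {C : Finset A}
    (hC : ∀ b, b ∈ C ↔ Commensurable (α a : UnitAddCircle) (α b) ∧
      p b • (height α y b 0 : UnitAddCircle) = p a • (height α y a 0 : UnitAddCircle)) :
    ∃ m : ℕ, 0 < m ∧ ∃ K : ℤ, ∀ᶠ n in atTop, ∑ b ∈ C, occ y b n m = K := by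
  -- One more candidate shift than letters, for the pigeonhole below.
  set J := Fintype.card A + 1 with hJ
  obtain ⟨W, hW, hpW⟩ : ∃ W : ℕ, 0 < W ∧ ∀ b, p b ∣ W :=
    ⟨(∏ b, p b).natAbs, Int.natAbs_pos.2 (Finset.prod_ne_zero_iff.2 fun b _ => hp0 b),
      fun b => Int.dvd_natAbs.2 (Finset.dvd_prod_of_mem p (Finset.mem_univ b))⟩
  have hpW' : ∀ b, |(p b : ℝ)| ≤ W := fun b => by
    have := Int.le_of_dvd (by exact_mod_cast hW) ((abs_dvd _ _).2 (hpW b))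
    exact_mod_cast this
  have hW1 : (1 : ℝ) ≤ W := by exact_mod_cast hW
  -- returns of the rotation by `α a` separating the letters that are not commensurable with `a`
  obtain ⟨η, hη, hret⟩ := exists_nsmul_near_zero_and_far
    (ι := {b : A // ¬ Commensurable (α a : UnitAddCircle) (α b) ∧
      ¬ IsOfFinAddOrder (α b : UnitAddCircle)} × Fin J)
    (β := fun i => ((i.2 + 1) * W) • (α i.1 : UnitAddCircle)) ha (by
      rintro ⟨⟨b, hb, hb'⟩, j⟩ k l h
      simp only at h
      by_contra hl
      rw [← natCast_zsmul, ← mul_zsmul] at h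
      have hl' : l * ((((j : ℕ) + 1) * W : ℕ) : ℤ) ≠ 0 := mul_ne_zero hl (by positivity)
      by_cases hk : k = 0
      · rw [hk, zero_zsmul, zero_add] at h
        exact hb' (isOfFinAddOrder_iff_zsmul_eq_zero.2 ⟨_, hl', h⟩)
      · exact hb ⟨k, _, hk, hl', h⟩)
  -- In order, the bounds on ε exclude two near-endpoint visits of a separated letter, force the
  -- rounded counts to sum to m, make rational letters exact, and detect commensurable letters that
  -- are out of phase.
  obtain ⟨ε, ⟨hε1, hε2, hε3, hε4⟩, hε⟩ : ∃ ε : ℝ, (ε < η / 2 ∧ ε < 1 / J ∧ ε < 1 ∧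
      ∀ b, p b • (height α y b 0 : UnitAddCircle) - p a • (height α y a 0 : UnitAddCircle) ≠ 0 →
        ε < ‖p b • (height α y b 0 : UnitAddCircle) - p a • (height α y a 0 : UnitAddCircle)‖
          / (2 * W)) ∧ 0 < ε := by
    have h : ∀ᶠ ε in 𝓝[>] (0 : ℝ), (ε < η / 2 ∧ ε < 1 / J ∧ ε < 1 ∧
      ∀ b, p b • (height α y b 0 : UnitAddCircle) - p a • (height α y a 0 : UnitAddCircle) ≠ 0 →
        ε < ‖p b • (height α y b 0 : UnitAddCircle) - p a • (height α y a 0 : UnitAddCircle)‖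
          / (2 * W)) := by
      refine (eventually_lt_nhdsGT_zero (by positivity)).and
        ((eventually_lt_nhdsGT_zero (by positivity)).and
        ((eventually_lt_nhdsGT_zero one_pos).and (eventually_all.2 fun b => ?_)))
      by_cases hb : p b • (height α y b 0 : UnitAddCircle)
          - p a • (height α y a 0 : UnitAddCircle) = 0
      · exact Eventually.of_forall fun _ h => absurd hb h
      · have : 0 < ‖p b • (height α y b 0 : UnitAddCircle)
            - p a • (height α y a 0 : UnitAddCircle)‖ := norm_pos_iff.2 hb
        filter_upwards [eventually_lt_nhdsGT_zero (c := ‖p b • (height α y b 0 : UnitAddCircle)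
          - p a • (height α y a 0 : UnitAddCircle)‖ / (2 * W)) (by positivity)] with ε h _
        exact h
    exact (h.and self_mem_nhdsWithin).exists
  obtain ⟨q, hq, hqz⟩ := exists_pos_forall_nsmul_eq_zero fun b => (α b : UnitAddCircle)
  obtain ⟨m', hm', hmε⟩ := exists_pos_forall_norm_nsmul_lt
    (fun b => q • (α b : UnitAddCircle)) hε
  set m := m' * q with hm
  have hm0 : 0 < m := Nat.mul_pos hm' hq
  set k : A → ℤ := fun b => round (m * α b) with hk
  have hkε : ∀ b, |m * α b - k b| < ε := fun b => by
    have := hmε b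
    rwa [smul_smul, ← AddCircle.coe_nsmul, UnitAddCircle.norm_eq, nsmul_eq_mul] at this
  have hsumk : ∑ b, k b = m := by
    have h1 : |((m - ∑ b, k b : ℤ) : ℝ)| < 1 := by
      have e : ((m - ∑ b, k b : ℤ) : ℝ) = ∑ b, (m * α b - k b) := by
        rw [Finset.sum_sub_distrib, ← Finset.mul_sum, hy.sum_slope]; push_cast; ring
      rw [e]
      calc _ ≤ ∑ b, |m * α b - k b| := Finset.abs_sum_le_sum_abs _ _
        _ ≤ ∑ b : A, ε := Finset.sum_le_sum fun b _ => (hkε b).le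
        _ = Fintype.card A * ε := by simp
        _ ≤ J * ε := by gcongr; rw [hJ]; linarith
        _ < 1 := by
          rw [lt_div_iff₀ (by positivity)] at hε2; linarith
    have h2 : |m - ∑ b, k b| < 1 := by exact_mod_cast h1
    have := Int.abs_lt_one_iff.1 h2
    omega
  have hfin : ∀ b, IsOfFinAddOrder (α b : UnitAddCircle) → ∀ᶠ n in atTop, occ y b n m = k b := by
    intro b hb
    obtain ⟨N, hN⟩ := hy.eventually_occ_eq hm0 (b := b) (by rw [hm, mul_nsmul', hqz b hb, nsmul_zero])
    filter_upwards [eventually_ge_atTop N] with n hn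
    have h := (hkε b).trans hε3
    rw [← hN n hn] at h
    have h2 : |occ y b n m - k b| < 1 := by exact_mod_cast h
    have := Int.abs_lt_one_iff.1 h2
    omega
  refine ⟨m, hm0, ∑ b ∈ C, k b, ?_⟩
  obtain ⟨N, hN⟩ := eventually_atTop.1 ((eventually_all.2 fun b => eventually_imp_distrib_left.2
    (hfin b)).and (eventually_all.2 fun b => eventually_imp_distrib_left.2
      (fun hb : ¬ IsOfFinAddOrder (α b : UnitAddCircle) =>
        eventually_coe_height_ne_zero (y := y) hb)))
  filter_upwards [eventually_ge_atTop N] with n hn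
  by_cases hev : ∀ c ∈ C, occ y c n m = k c
  · exact Finset.sum_congr rfl hev
  push Not at hev
  obtain ⟨c₀, hc₀, hne⟩ := hev
  have hCirr : ∀ c ∈ C, ¬ IsOfFinAddOrder (α c : UnitAddCircle) := fun c hc =>
    ((hC c).1 hc).1.not_isOfFinAddOrder ha
  obtain ⟨γ, hγ, hγ0⟩ : ∃ γ : ℝ, (∀ c, c ∈ C → (γ < height α y c n ∧ γ < 1 - height α y c n ∧
      γ < height α y c (n + m) ∧ γ < 1 - height α y c (n + m))) ∧ 0 < γ := by
    have h : ∀ᶠ γ in 𝓝[>] (0 : ℝ), ∀ c, c ∈ C → (γ < height α y c n ∧ γ < 1 - height α y c n ∧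
        γ < height α y c (n + m) ∧ γ < 1 - height α y c (n + m)) := by
      refine eventually_all.2 fun c => eventually_imp_distrib_left.2 fun hc => ?_
      have h1 := hy.height_mem_Ioo ((hN n hn).2 c (hCirr c hc))
      have h2 := hy.height_mem_Ioo ((hN (n + m) (by omega)).2 c (hCirr c hc))
      exact (eventually_lt_nhdsGT_zero h1.1).and ((eventually_lt_nhdsGT_zero
        (sub_pos.2 h1.2)).and ((eventually_lt_nhdsGT_zero h2.1).and
        (eventually_lt_nhdsGT_zero (sub_pos.2 h2.2))))
    exact (h.and self_mem_nhdsWithin).exists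
  -- Each of the J shifts is a multiple of t and moves a height in C by at most J * W * W times the
  -- return error, hence by less than γ.
  obtain ⟨t, ht, ht'⟩ := hret (γ / (J * W * W)) (by positivity)
  let s : Fin J → ℕ := fun j => (j + 1) * W * t
  have hCs : ∀ j, ∀ c ∈ C, occ y c (n + s j) m = occ y c n m := by
    intro j c hc
    obtain ⟨g1, g2, g3, g4⟩ := hγ c hc
    refine hy.occ_add_eq_of_height_mem (γ := γ) g1 (by linarith) g3 (by linarith) ?_
    have hj : ((j : ℕ) : ℝ) + 1 ≤ J := by exact_mod_cast j.2
    calc _ ≤ ((j + 1 : ℕ) : ℝ) * W * |(p a : ℝ)| * ‖t • (α a : UnitAddCircle)‖ :=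
          norm_nsmul_le_of_zsmul_eq_zsmul hW (hpW c) (hp c ((hC c).1 hc).1) _ _
      _ ≤ J * W * W * ‖t • (α a : UnitAddCircle)‖ := by
          push_cast
          gcongr
          exact hpW' a
      _ < J * W * W * (γ / (J * W * W)) := by gcongr
      _ = γ := mul_div_cancel₀ _ (by positivity)
  -- An irregular count puts the height within ε of 0 on the circle. As `c₀` stays irregular under
  -- all shifts, a commensurable letter outside C cannot be irregular with it, its phase difference
  -- being too large. A letter not commensurable with `a` spoils at most one shift, because
  -- differences of shifts move it by at least η.
  obtain ⟨j, hj⟩ : ∃ j, ∀ b ∉ C, occ y b (n + s j) m = k b := by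
    by_contra! hbad
    choose f hfC hf using hbad
    have hfirr : ∀ j, ¬ IsOfFinAddOrder (α (f j) : UnitAddCircle) := fun j h =>
      hf j ((hN _ (by omega)).1 _ h)
    have hfcom : ∀ j, ¬ Commensurable (α a : UnitAddCircle) (α (f j)) := by
      intro j hcom
      have hne' : p (f j) • (height α y (f j) 0 : UnitAddCircle)
          - p a • (height α y a 0 : UnitAddCircle) ≠ 0 := fun h =>
        hfC j ((hC _).2 ⟨hcom, sub_eq_zero.1 h⟩)
      have hlt := hε4 _ hne'
      rw [← zsmul_height_sub (hp _ hcom) (n + s j), lt_div_iff₀ (by positivity)] at hlt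
      have hca : p c₀ • (height α y c₀ (n + s j) : UnitAddCircle)
          = p a • (height α y a (n + s j) : UnitAddCircle) := by
        rw [← sub_eq_zero, zsmul_height_sub (hp _ ((hC c₀).1 hc₀).1), sub_eq_zero]
        exact ((hC c₀).1 hc₀).2
      rw [← hca] at hlt
      have h1 := hy.norm_height_le_of_occ_ne (hkε (f j)) (hf j)
      have h2 := hy.norm_height_le_of_occ_ne (n := n + s j) (hkε c₀) (by rw [hCs j c₀ hc₀]; exact hne)
      have h3 : ∀ b, ‖(height α y b (n + s j) : UnitAddCircle)‖ ≤ ε →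
          ‖p b • (height α y b (n + s j) : UnitAddCircle)‖ ≤ W * ε := by
        intro b hb
        refine (norm_zsmul_le _ _).trans ?_
        rw [Int.norm_eq_abs]
        have := hpW' b
        gcongr
      have h4 := norm_sub_le (p (f j) • (height α y (f j) (n + s j) : UnitAddCircle))
        (p c₀ • (height α y c₀ (n + s j) : UnitAddCircle))
      linarith [h3 _ h1, h3 _ h2]
    obtain ⟨i, j, hij, hfij⟩ := Fintype.exists_ne_map_eq_of_card_lt f (by simp [hJ])
    wlog hlt : i < j generalizing i j
    · exact this j i hij.symm hfij.symm (lt_of_le_of_ne (not_lt.1 hlt) hij.symm)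
    have hlt' : (i : ℕ) < j := hlt
    have h1 := hy.norm_height_le_of_occ_ne (hkε (f i)) (hf i)
    have h2 := hy.norm_height_le_of_occ_ne (hkε (f j)) (hf j)
    obtain ⟨d, hd⟩ := Nat.exists_eq_add_of_lt hlt'
    have h3 := ht' (⟨f j, hfcom j, hfirr j⟩, ⟨d, by omega⟩)
    have e : s j = s i + (d + 1) * W * t := by simp only [s]; rw [hd]; ring
    rw [hfij] at h1
    rw [e, ← add_assoc, coe_height_add] at h2
    have h4 := norm_sub_le ((height α y (f j) (n + s i) : UnitAddCircle)
      + ((d + 1) * W * t) • (α (f j) : UnitAddCircle)) (height α y (f j) (n + s i) : UnitAddCircle)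
    rw [add_sub_cancel_left] at h4
    simp only [smul_smul] at h3
    rw [mul_comm t] at h3
    linarith
  have e1 : ∑ b ∈ C, occ y b n m = ∑ b ∈ C, occ y b (n + s j) m :=
    Finset.sum_congr rfl fun c hc => (hCs j c hc).symm
  have e2 := Finset.sum_add_sum_compl C fun b => occ y b (n + s j) m
  have e3 := Finset.sum_add_sum_compl C k
  have e4 : ∑ b ∈ Cᶜ, occ y b (n + s j) m = ∑ b ∈ Cᶜ, k b :=
    Finset.sum_congr rfl fun b hb => hj b (Finset.mem_compl.1 hb)
  rw [sum_occ] at e2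
  linarith

theorem commensurable_and_zsmul_height_eq (hy : IsBalancedWith α y) {a : A}
    (ha : ¬ IsOfFinAddOrder (α a : UnitAddCircle)) {p : A → ℤ} (hp0 : ∀ b, p b ≠ 0)
    (hp : ∀ b, Commensurable (α a : UnitAddCircle) (α b) →
      p b • (α b : UnitAddCircle) = p a • (α a : UnitAddCircle)) {b : A} (hb : α b ≠ 0) :
    Commensurable (α a : UnitAddCircle) (α b) ∧
      p b • (height α y b 0 : UnitAddCircle) = p a • (height α y a 0 : UnitAddCircle) := by
  classical
  obtain ⟨C, hC⟩ : ∃ C : Finset A, ∀ b, b ∈ C ↔ Commensurable (α a : UnitAddCircle) (α b) ∧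
      p b • (height α y b 0 : UnitAddCircle) = p a • (height α y a 0 : UnitAddCircle) :=
    ⟨Finset.univ.filter fun b => Commensurable (α a : UnitAddCircle) (α b) ∧
      p b • (height α y b 0 : UnitAddCircle) = p a • (height α y a 0 : UnitAddCircle), by simp⟩
  rw [← hC]
  obtain ⟨m, hm, K, hK⟩ := hy.exists_sum_occ_eq ha hp0 hp hC
  obtain ⟨N, hN⟩ := eventually_atTop.1 hK
  have hind : ∀ n, (∑ c ∈ C, if y n = c then (1 : ℤ) else 0) = if y n ∈ C then 1 else 0 := by
    intro n; simp
  have hper : ∀ n ≥ N, (y (n + m) ∈ C ↔ y n ∈ C) := by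
    intro n hn
    have h1 := hN n hn
    have h2 := hN (n + 1) (by omega)
    simp only [occ_shift, Finset.sum_add_distrib, Finset.sum_sub_distrib, hind] at h2
    by_cases g1 : y (n + m) ∈ C <;> by_cases g2 : y n ∈ C <;> simp [g1, g2] at h2 ⊢ <;> omega
  have hper' : ∀ n ≥ N, ∀ j : ℕ, (y (n + j * m) ∈ C ↔ y n ∈ C) := by
    intro n hn j
    induction j with
    | zero => simp
    | succ j ih => rw [Nat.succ_mul, ← add_assoc, hper _ (by omega), ih]
  have haC : a ∈ C := (hC a).2 ⟨Commensurable.refl _, rfl⟩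
  have ha0 : 0 < α a := (hy.slope_nonneg a).lt_of_ne fun h => ha (by
    rw [← h, AddCircle.coe_zero]; exact IsOfFinAddOrder.zero)
  -- The rotation by `m • α a` is irrational, so along n + j * m the height of `a` enters (1 - `α
  -- a`, 1), where `a` must be read.
  have hall : ∀ n ≥ N, y n ∈ C := by
    intro n hn
    have hma : ¬ IsOfFinAddOrder (m • (α a : UnitAddCircle)) := fun h => ha (h.of_nsmul hm.ne')
    obtain ⟨j, -, hj⟩ := exists_ge_nsmul_near hma (η := α a / 2) (by positivity)
      ((1 - α a / 2 - height α y a n : ℝ) : UnitAddCircle) 0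
    rw [← hper' n hn j]
    suffices y (n + j * m) = a by rwa [this]
    apply hy.eq_of_lt_height
    rw [smul_smul] at hj
    have e : (j * m) • (α a : UnitAddCircle) - ((1 - α a / 2 - height α y a n : ℝ) : UnitAddCircle)
        = ((height α y a (n + j * m) - (1 - α a / 2) : ℝ) : UnitAddCircle) := by
      simp only [AddCircle.coe_sub, coe_height_add]; abel
    rw [e, UnitAddCircle.norm_eq, abs_lt] at hj
    set r := round (height α y a (n + j * m) - (1 - α a / 2))
    have g1 := hy.slope_le_one a
    have g2 := hy.height_nonneg a (n + j * m)
    have g3 := hy.height_le_one a (n + j * m)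
    have hr1 : (r : ℝ) < 1 := by linarith
    have hr2 : (-1 : ℝ) < r := by linarith
    have hr1' : r < 1 := by exact_mod_cast hr1
    have hr2' : -1 < r := by exact_mod_cast hr2
    have : r = 0 := by omega
    rw [this] at hj
    push_cast at hj
    linarith
  by_contra hbC
  have hb0 : 0 < α b := (hy.slope_nonneg b).lt_of_ne' hb
  obtain ⟨n, hn⟩ := exists_nat_gt (1 / α b)
  rw [div_lt_iff₀ hb0] at hn
  have h1 := (abs_le.1 (hy.abs_occ_sub_le b N n)).1
  have h2 : occ y b N n = 0 := by
    have : ∀ q, occ y b N q = 0 := by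
      intro q
      induction q with
      | zero => exact occ_zero _ _ _
      | succ q ih =>
        rw [occ_succ, ih, if_neg, add_zero]
        intro h
        exact hbC (h ▸ hall (N + q) (by omega))
    exact this n
  rw [h2] at h1
  push_cast at h1
  linarith

end IsBalancedWith

end AbelianClosure

/-! ### A long common factor transfers every factor. -/

namespace AbelianClosure

open Filter Topology

theorem exists_eq_add_intCast {x z : ℝ} (h : (x : UnitAddCircle) = z) : ∃ k : ℤ, x = z + k := by
  rw [← sub_eq_zero, ← AddCircle.coe_sub, AddCircle.coe_eq_zero_iff] at h
  obtain ⟨k, hk⟩ := h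
  exact ⟨k, by simp at hk; linarith⟩

variable {A : Type*} [DecidableEq A] {α : A → ℝ} {y z : ℕ → A}

namespace IsBalancedWith

/-- Within N steps the height of `b` in `y` falls below η. Along the common block the difference of
heights is constant, and the height in `z` is nonnegative. -/
theorem height_sub_height_le (hy : IsBalancedWith α y) (hz : IsBalancedWith α z) {b : A} {η : ℝ}
    {N : ℕ} (hN : ∀ x : UnitAddCircle, ∃ n < N, ‖n • (α b : UnitAddCircle) - x‖ < η / 2)
    {i j : ℕ} (hyz : ∀ q < N, y (i + q) = z (j + q)) :
    height α y b i - height α z b j ≤ η := by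
  obtain ⟨n, hn, h⟩ := hN ((η / 2 - height α y b i : ℝ) : UnitAddCircle)
  have e : n • (α b : UnitAddCircle) - ((η / 2 - height α y b i : ℝ) : UnitAddCircle)
      = ((height α y b (i + n) - η / 2 : ℝ) : UnitAddCircle) := by
    simp only [AddCircle.coe_sub, coe_height_add]; abel
  rw [e, UnitAddCircle.norm_eq, abs_lt] at h
  set r := round (height α y b (i + n) - η / 2)
  have g1 := height_add α y b i n
  have g2 := height_add α z b j n
  rw [← occ_congr (y := y) (i := i) fun q hq => hyz q (hq.trans hn)] at g2
  have g3 := hz.height_nonneg b (j + n)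
  have g4 := hy.height_le_one b (i + n)
  have hr : (r : ℝ) ≤ 0 ∨ (1 : ℝ) ≤ r := by
    rcases le_or_gt r 0 with h | h
    · left; exact_mod_cast h
    · right; exact_mod_cast h
  rcases hr with hr | hr
  · linarith
  · linarith

theorem sum_height_filter [Fintype A] (hy : IsBalancedWith α y) (n : ℕ) :
    ∑ b with α b ≠ 0, height α y b n = ∑ b with α b ≠ 0, height α y b 0 := by
  have h1 := Finset.sum_filter_add_sum_filter_not Finset.univ (fun b => α b ≠ 0)
    fun b => height α y b n
  have h2 := Finset.sum_filter_add_sum_filter_not Finset.univ (fun b => α b ≠ 0)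
    fun b => height α y b 0
  have h3 : ∑ b with ¬ α b ≠ 0, height α y b n = ∑ b with ¬ α b ≠ 0, height α y b 0 :=
    Finset.sum_congr rfl fun b hb =>
      hy.height_of_slope_eq_zero (not_not.1 (Finset.mem_filter.1 hb).2) n
  rw [hy.sum_height] at h1
  linarith

/-- For letters in phase with `a`, an endpoint visit makes `p a • height a` vanish on the circle; an
irrational orbit does so at most once. -/
theorem eq_of_coe_height_eq_zero {a b b' : A} (ha : ¬ IsOfFinAddOrder (α a : UnitAddCircle))
    {p : A → ℤ} (hpa : p a ≠ 0)
    (hb : ∀ n, p b • (height α z b n : UnitAddCircle) = p a • (height α z a n : UnitAddCircle))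
    (hb' : ∀ n, p b' • (height α z b' n : UnitAddCircle) = p a • (height α z a n : UnitAddCircle))
    {n n' : ℕ} (h : (height α z b n : UnitAddCircle) = 0)
    (h' : (height α z b' n' : UnitAddCircle) = 0) : n = n' := by
  have e1 := hb n
  have e2 := hb' n'
  rw [h, zsmul_zero] at e1
  rw [h', zsmul_zero] at e2
  have e : p a • (height α z a n : UnitAddCircle) = p a • (height α z a n' : UnitAddCircle) :=
    e1.symm.trans e2
  clear e1 e2 h h' hb hb'
  wlog hle : n ≤ n' generalizing n n'
  · exact (this e.symm (le_of_not_ge hle)).symm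
  obtain ⟨k, rfl⟩ := Nat.exists_eq_add_of_le hle
  rw [coe_height_add, zsmul_add, left_eq_add, ← natCast_zsmul, ← mul_zsmul] at e
  by_contra hk
  exact ha (isOfFinAddOrder_iff_zsmul_eq_zero.2
    ⟨_, mul_ne_zero hpa (Int.natCast_ne_zero.2 (by omega)), e⟩)

theorem exists_coe_height_eq_add {a : A} (ha : ¬ IsOfFinAddOrder (α a : UnitAddCircle))
    {p : A → ℤ} (hp0 : ∀ b, p b ≠ 0) {W : ℕ} (hW : 0 < W) (hpW : ∀ b, p b ∣ W)
    (hp : ∀ b, α b ≠ 0 → p b • (α b : UnitAddCircle) = p a • (α a : UnitAddCircle))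
    {i j : ℕ} {G : ℝ} (hG : ∀ b, α b ≠ 0 → p b * (height α y b i - height α z b j) = G)
    (k : ℕ) {c d : ℝ} (hcd : c < d) :
    ∃ s : ℕ, ∃ θ : ℝ, c < θ ∧ θ < d ∧ ∀ b, α b ≠ 0 →
      (height α y b s : UnitAddCircle) = ((height α z b k + θ / p b : ℝ) : UnitAddCircle) := by
  have hβ : ¬ IsOfFinAddOrder (p a • (α a : UnitAddCircle)) := by
    intro h
    obtain ⟨n, hn, h⟩ := isOfFinAddOrder_iff_zsmul_eq_zero.1 h
    exact ha (isOfFinAddOrder_iff_zsmul_eq_zero.2 ⟨n * p a, mul_ne_zero hn (hp0 a), by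
      rw [mul_zsmul, h]⟩)
  have hW0 : (0 : ℝ) < W := by exact_mod_cast hW
  obtain ⟨n, hnj, hn⟩ := exists_ge_nsmul_near hβ (η := (d - c) / (2 * W))
    (div_pos (sub_pos.2 hcd) (by positivity)) (((-G + (c + d) / 2) / W : ℝ) : UnitAddCircle) j
  obtain ⟨x, hx⟩ : ∃ x : ℝ, n • p a • (α a : UnitAddCircle) = (x : UnitAddCircle) :=
    ⟨n • p a • α a, by simp⟩
  rw [hx, ← AddCircle.coe_sub, UnitAddCircle.norm_eq] at hn
  set r := round (x - (-G + (c + d) / 2) / W)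
  set e := x - (-G + (c + d) / 2) / W - r with he
  have hx' : (x : UnitAddCircle) = (((-G + ((c + d) / 2 + W * e)) / W : ℝ) : UnitAddCircle) := by
    rw [← sub_eq_zero, ← AddCircle.coe_sub, AddCircle.coe_eq_zero_iff]
    refine ⟨r, ?_⟩
    rw [zsmul_eq_mul, mul_one, he]
    field_simp
    ring
  have hj : j ≤ W * n := hnj.trans (Nat.le_mul_of_pos_left n hW)
  rw [lt_div_iff₀ (by positivity)] at hn
  have hn1 := neg_abs_le e
  have hn2 := le_abs_self e
  have hWe : |e| * W < (d - c) / 2 := by linarith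
  have hWe1 : -|e| * W ≤ W * e := by rw [mul_comm (W : ℝ)]; gcongr
  have hWe2 : W * e ≤ |e| * W := by rw [mul_comm (W : ℝ)]; gcongr
  -- Here n ≥ j keeps the subtraction exact. The target was divided by W so that, for every `b`, the
  -- integer multiple W / `p b` gives the displacement (-G + θ) / `p b` on the circle.
  refine ⟨i + W * n + k - j, (c + d) / 2 + W * e, by linarith, by linarith, fun b hb => ?_⟩
  set θ := (c + d) / 2 + W * e
  have hpb : (p b : ℝ) ≠ 0 := by exact_mod_cast hp0 b
  obtain ⟨w, hw⟩ := hpW b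
  have hw' : (W : ℝ) = p b * w := by exact_mod_cast hw
  have h1 : (W * n) • (α b : UnitAddCircle) = (((-G + θ) / p b : ℝ) : UnitAddCircle) := by
    have : (W * n) • (α b : UnitAddCircle) = w • (x : UnitAddCircle) := by
      rw [← hx, ← hp b hb, ← natCast_zsmul, ← natCast_zsmul _ n, smul_smul, smul_smul]
      congr 1
      push_cast
      rw [hw]; ring
    rw [this, hx', ← AddCircle.coe_zsmul]
    congr 1
    rw [zsmul_eq_mul, hw']
    have : (w : ℝ) ≠ 0 := by
      rintro h; rw [h, mul_zero] at hw'; linarith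
    field_simp
  have h2 := coe_height_add α y b (i + W * n + k - j) j
  have h3 := coe_height_add α y b i (W * n + k)
  have h4 := coe_height_add α z b 0 j
  have h5 := coe_height_add α z b 0 k
  rw [show i + W * n + k - j + j = i + (W * n + k) by omega, h3, add_nsmul, h1] at h2
  rw [zero_add] at h4 h5
  have hgb := hG b hb
  have e6 : θ / p b = height α y b i - height α z b j + (-G + θ) / p b := by
    rw [← hgb]; field_simp; ring
  rw [e6]
  simp only [AddCircle.coe_add, AddCircle.coe_sub]
  rw [h4, h5, ← sub_eq_zero]
  rw [← sub_eq_zero] at h2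
  rw [← neg_eq_zero, ← h2]
  abel

/-- The heights differ by `τ` plus integers `w`, which can be nonzero only at endpoint visits of
`z`, and negative only at height 1 with `τ b > 0`. Otherwise they are nonnegative with constant sum,
zero at a position free of visits; so all vanish, and reading different letters would break this at
the next position. -/
theorem eq_or_exists_height_eq_one [Fintype A] (hy : IsBalancedWith α y) (hz : IsBalancedWith α z)
    {s k L : ℕ} {γ : ℝ} {τ : A → ℝ} (hγ : γ < 1 / 2)
    (hmem : ∀ b, α b ≠ 0 → ∀ q ≤ L, (height α z b (k + q) : UnitAddCircle) ≠ 0 →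
      γ < height α z b (k + q) ∧ γ < 1 - height α z b (k + q))
    (hex : ∃ q ≤ L, ∀ b, α b ≠ 0 → (height α z b (k + q) : UnitAddCircle) ≠ 0)
    (hτ : ∀ b, α b ≠ 0 → |τ b| < γ ∧ τ b ≠ 0)
    (heq : ∀ b, α b ≠ 0 → (height α y b s : UnitAddCircle) =
      ((height α z b k + τ b : ℝ) : UnitAddCircle)) :
    (∀ q < L, y (s + q) = z (k + q)) ∨
      ∃ b, α b ≠ 0 ∧ ∃ q ≤ L, height α z b (k + q) = 1 ∧ 0 < τ b := by
  by_contra! hcon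
  obtain ⟨hne, hcon⟩ := hcon
  have hw : ∀ b q, α b ≠ 0 → ∃ w : ℤ, height α y b (s + q) = height α z b (k + q) + τ b + w := by
    intro b q hb
    refine exists_eq_add_intCast ?_
    rw [coe_height_add, heq b hb, AddCircle.coe_add, AddCircle.coe_add, coe_height_add]
    abel
  choose! w hw using hw
  have hbd : ∀ b, α b ≠ 0 → -γ < τ b ∧ τ b < γ := fun b hb => abs_lt.1 (hτ b hb).1
  have hint : ∀ b, α b ≠ 0 → ∀ q ≤ L, (height α z b (k + q) : UnitAddCircle) ≠ 0 → w b q = 0 := by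
    intro b hb q hq h
    obtain ⟨h1, h2⟩ := hmem b hb q hq h
    have h3 := hw b q hb
    have h4 := hy.height_nonneg b (s + q)
    have h5 := hy.height_le_one b (s + q)
    obtain ⟨h6, h7⟩ := hbd b hb
    have g1 : (w b q : ℝ) < 1 := by linarith
    have g2 : (-1 : ℝ) < w b q := by linarith
    have g1' : w b q < 1 := by exact_mod_cast g1
    have g2' : -1 < w b q := by exact_mod_cast g2
    omega
  have hnonneg : ∀ b, α b ≠ 0 → ∀ q ≤ L, 0 ≤ w b q := by
    intro b hb q hq
    by_cases h : (height α z b (k + q) : UnitAddCircle) = 0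
    · by_contra! hlt
      have hlt' : (w b q : ℝ) ≤ -1 := by exact_mod_cast Int.le_sub_one_of_lt hlt
      have h3 := hw b q hb
      have h4 := hy.height_nonneg b (s + q)
      obtain ⟨h6, h7⟩ := hbd b hb
      rcases hz.coe_height_eq_zero_iff.1 h with h0 | h0
      · linarith
      · exact (hτ b hb).2 (le_antisymm (hcon b hb q hq h0) (by linarith))
    · exact (hint b hb q hq h).ge
  have hsum : ∀ q, (∑ b with α b ≠ 0, (w b q : ℝ)) = ∑ b with α b ≠ 0, height α y b 0
      - ∑ b with α b ≠ 0, height α z b 0 - ∑ b with α b ≠ 0, τ b := by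
    intro q
    rw [← hy.sum_height_filter (s + q), ← hz.sum_height_filter (k + q), ← Finset.sum_sub_distrib,
      ← Finset.sum_sub_distrib]
    refine Finset.sum_congr rfl fun b hb => ?_
    have := hw b q (Finset.mem_filter.1 hb).2
    linarith
  obtain ⟨q₀, hq₀, h₀⟩ := hex
  have hsum0 : ∀ q, (∑ b with α b ≠ 0, w b q) = 0 := by
    intro q
    have h1 : (∑ b with α b ≠ 0, (w b q : ℝ)) = ∑ b with α b ≠ 0, (w b q₀ : ℝ) :=
      (hsum q).trans (hsum q₀).symm
    have h2 : (∑ b with α b ≠ 0, w b q) = ∑ b with α b ≠ 0, w b q₀ := by exact_mod_cast h1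
    rw [h2]
    exact Finset.sum_eq_zero fun b hb =>
      hint b (Finset.mem_filter.1 hb).2 q₀ hq₀ (h₀ b (Finset.mem_filter.1 hb).2)
  have hw0 : ∀ b, α b ≠ 0 → ∀ q ≤ L, w b q = 0 := by
    intro b hb q hq
    refine (Finset.sum_eq_zero_iff_of_nonneg fun c hc => ?_).1 (hsum0 q) b (by simpa using hb)
    exact hnonneg c (Finset.mem_filter.1 hc).2 q hq
  obtain ⟨q, hq, hneq⟩ := hne
  have hb := (hz.slope_pos (k + q)).ne'
  have h1 := hw _ q hb
  have h2 := hw _ (q + 1) hb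
  rw [hw0 _ hb q hq.le] at h1
  rw [hw0 _ hb (q + 1) hq, ← add_assoc, ← add_assoc, height_succ, height_succ, if_neg hneq,
    if_pos rfl] at h2
  push_cast at h1 h2
  linarith

theorem exists_forall_factor_of_common_factor [Fintype A] {a : A}
    (ha : ¬ IsOfFinAddOrder (α a : UnitAddCircle))
    (hirr : ∀ b, α b ≠ 0 → ¬ IsOfFinAddOrder (α b : UnitAddCircle)) {p : A → ℤ}
    (hp0 : ∀ b, p b ≠ 0)
    (hp : ∀ b, α b ≠ 0 → p b • (α b : UnitAddCircle) = p a • (α a : UnitAddCircle))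
    (hph : ∀ y, IsBalancedWith α y → ∀ b, α b ≠ 0 → ∀ n,
      p b • (height α y b n : UnitAddCircle) = p a • (height α y a n : UnitAddCircle)) :
    ∃ N : ℕ, ∀ y z, IsBalancedWith α y → IsBalancedWith α z → ∀ i j,
      (∀ q < N, y (i + q) = z (j + q)) → ∀ k L, ∃ s, ∀ q < L, y (s + q) = z (k + q) := by
  obtain ⟨W, hW, hpW⟩ : ∃ W : ℕ, 0 < W ∧ ∀ b, p b ∣ W :=
    ⟨(∏ b, p b).natAbs, Int.natAbs_pos.2 (Finset.prod_ne_zero_iff.2 fun b _ => hp0 b),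
      fun b => Int.dvd_natAbs.2 (Finset.dvd_prod_of_mem p (Finset.mem_univ b))⟩
  have hpW' : ∀ b, |(p b : ℝ)| ≤ W := fun b => by
    have := Int.le_of_dvd (by exact_mod_cast hW) ((abs_dvd _ _).2 (hpW b))
    exact_mod_cast this
  have hW0 : (0 : ℝ) < W := by exact_mod_cast hW
  -- After multiplication by `p b` the height differences are at most 1 / 3, so congruence modulo 1
  -- becomes equality.
  have hη : (0 : ℝ) < 1 / (3 * W) := by positivity
  have hdens : ∀ b, ∃ N : ℕ, α b ≠ 0 → ∀ x : UnitAddCircle, ∃ n < N,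
      ‖n • (α b : UnitAddCircle) - x‖ < 1 / (3 * W) / 2 := by
    intro b
    by_cases hb : α b ≠ 0
    · obtain ⟨N, hN⟩ := exists_nat_forall_exists_nsmul_near (hirr b hb) (half_pos hη)
      exact ⟨N, fun _ => hN⟩
    · exact ⟨0, fun h => absurd h hb⟩
  choose N hN using hdens
  refine ⟨Finset.univ.sup N, fun y z hy hz i j hyz k L => ?_⟩
  rcases Nat.eq_zero_or_pos L with rfl | hL
  · exact ⟨0, fun q hq => absurd hq (Nat.not_lt_zero q)⟩
  have hNb : ∀ b, ∀ q < N b, y (i + q) = z (j + q) := fun b q hq =>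
    hyz q (hq.trans_le (Finset.le_sup (f := N) (Finset.mem_univ b)))
  have hsmall : ∀ b, α b ≠ 0 → |p b * (height α y b i - height α z b j)| ≤ 1 / 3 := by
    intro b hb
    have h1 := hy.height_sub_height_le hz (hN b hb) (hNb b)
    have h2 := hz.height_sub_height_le hy (hN b hb) (fun q hq => (hNb b q hq).symm)
    have h3 : |height α y b i - height α z b j| ≤ 1 / (3 * W) := by
      rw [abs_le]; constructor <;> linarith
    rw [abs_mul]
    calc _ ≤ (W : ℝ) * (1 / (3 * W)) := by
          have := hpW' b
          gcongr
      _ = 1 / 3 := by field_simp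
  have ha0 : α a ≠ 0 := fun h => ha (by
    rw [h, AddCircle.coe_zero]; exact IsOfFinAddOrder.zero)
  have hG : ∀ b, α b ≠ 0 → p b * (height α y b i - height α z b j)
      = p a * (height α y a i - height α z a j) := by
    intro b hb
    obtain ⟨r, hr⟩ := exists_eq_add_intCast (x := p b * (height α y b i - height α z b j))
      (z := p a * (height α y a i - height α z a j)) (by
        rw [← zsmul_eq_mul, ← zsmul_eq_mul, AddCircle.coe_zsmul, AddCircle.coe_zsmul,
          AddCircle.coe_sub, AddCircle.coe_sub, zsmul_sub, zsmul_sub, hph y hy b hb,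
          hph z hz b hb])
    have h1 := abs_le.1 (hsmall b hb)
    have h2 := abs_le.1 (hsmall a ha0)
    have g1 : (r : ℝ) < 1 := by linarith
    have g2 : (-1 : ℝ) < r := by linarith
    have g1' : r < 1 := by exact_mod_cast g1
    have g2' : -1 < r := by exact_mod_cast g2
    have : r = 0 := by omega
    rw [hr, this]; simp
  obtain ⟨γ, ⟨hγ, hγ2⟩, hγ0⟩ : ∃ γ : ℝ, ((∀ b, α b ≠ 0 → ∀ q ≤ L,
      (height α z b (k + q) : UnitAddCircle) ≠ 0 →
        γ < height α z b (k + q) ∧ γ < 1 - height α z b (k + q)) ∧ γ < 1 / 2) ∧ 0 < γ := by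
    have h : ∀ᶠ γ in 𝓝[>] (0 : ℝ), (∀ b, α b ≠ 0 → ∀ q ≤ L,
      (height α z b (k + q) : UnitAddCircle) ≠ 0 →
        γ < height α z b (k + q) ∧ γ < 1 - height α z b (k + q)) ∧ γ < 1 / 2 := by
      refine Eventually.and ?_ (eventually_lt_nhdsGT_zero (by norm_num))
      refine eventually_all.2 fun b => eventually_imp_distrib_left.2 fun _ => ?_
      refine (eventually_all_finite (Set.finite_Iic L)).2 fun q _ =>
        eventually_imp_distrib_left.2 fun h => ?_
      have h1 := hz.height_mem_Ioo h
      exact (eventually_lt_nhdsGT_zero h1.1).and (eventually_lt_nhdsGT_zero (sub_pos.2 h1.2))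
    exact (h.and self_mem_nhdsWithin).exists
  have huniq : ∀ b b' n n', α b ≠ 0 → α b' ≠ 0 → (height α z b n : UnitAddCircle) = 0 →
      (height α z b' n' : UnitAddCircle) = 0 → n = n' := fun b b' n n' hb hb' h h' =>
    eq_of_coe_height_eq_zero ha (hp0 a) (hph z hz b hb) (hph z hz b' hb') h h'
  have hex : ∃ q ≤ L, ∀ b, α b ≠ 0 → (height α z b (k + q) : UnitAddCircle) ≠ 0 := by
    by_contra! h
    obtain ⟨b, hb, h1⟩ := h 0 (by omega)
    obtain ⟨b', hb', h2⟩ := h 1 hL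
    have := huniq b b' _ _ hb hb' h1 h2
    omega
  have hside : ∀ c d : ℝ, c < d → -γ ≤ c → d ≤ γ → (d ≤ 0 ∨ 0 ≤ c) →
      (∃ s, ∀ q < L, y (s + q) = z (k + q)) ∨
      ∃ b, α b ≠ 0 ∧ ∃ q ≤ L, height α z b (k + q) = 1 ∧ ∃ θ : ℝ, c < θ ∧ θ < d ∧ 0 < θ / p b := by
    intro c d hcd hc hd h0
    obtain ⟨s, θ, h1, h2, h3⟩ := exists_coe_height_eq_add ha hp0 hW hpW hp hG k hcd
    have hθ : θ ≠ 0 := by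
      rcases h0 with h0 | h0
      · exact (h2.trans_le h0).ne
      · exact (h0.trans_lt h1).ne'
    have hθγ : |θ| < γ := abs_lt.2 ⟨by linarith, by linarith⟩
    refine (hy.eq_or_exists_height_eq_one hz (τ := fun b => θ / p b) hγ2 hγ hex
      (fun b _ => ⟨?_, div_ne_zero hθ (Int.cast_ne_zero.2 (hp0 b))⟩) h3).imp
      (fun h => ⟨s, h⟩) ?_
    · have : (1 : ℝ) ≤ |(p b : ℝ)| := by exact_mod_cast Int.one_le_abs (hp0 b)
      rw [abs_div]
      exact (div_le_self (abs_nonneg _) this).trans_lt hθγ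
    · rintro ⟨b, hb, q, hq, h4, h5⟩
      exact ⟨b, hb, q, hq, h4, θ, h1, h2, h5⟩
  rcases hside 0 γ hγ0 (by linarith) le_rfl (Or.inr le_rfl) with h | h
  · exact h
  rcases hside (-γ) 0 (by linarith) le_rfl hγ0.le (Or.inl le_rfl) with h' | h'
  · exact h'
  -- Failure for both signs of θ gives letters of height 1 with multipliers of opposite signs. Both
  -- visits occur at the same position, and height 1 determines the letter read, so the two letters
  -- coincide.
  obtain ⟨b, hb, q, -, h1, θ, hθ, -, hpos⟩ := h
  obtain ⟨b', hb', q', -, h1', θ', -, hθ', hpos'⟩ := h'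
  have hqq := huniq b b' _ _ hb hb' (hz.coe_height_eq_zero_iff.2 (Or.inr h1))
    (hz.coe_height_eq_zero_iff.2 (Or.inr h1'))
  have hlet : ∀ c n, α c ≠ 0 → height α z c n = 1 → z n = c := fun c n hc h =>
    hz.eq_of_lt_height (by rw [h]; linarith [(hz.slope_nonneg c).lt_of_ne' hc])
  have hbb : b = b' := by
    rw [← hlet b _ hb h1, hqq, hlet b' _ hb' h1']
  subst hbb
  rcases div_pos_iff.1 hpos with ⟨-, h⟩ | ⟨h, -⟩
  · rcases div_pos_iff.1 hpos' with ⟨h', -⟩ | ⟨-, h'⟩ <;> linarith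
  · linarith

end IsBalancedWith

end AbelianClosure

/-! ### Languages, subshifts and the conclusion. -/

namespace AbelianClosure

open Filter Topology

theorem language_subset_iff {A : Type*} {z y : ℕ → A} :
    language z ⊆ language y ↔ ∀ i n, ∃ j, ∀ q < n, y (j + q) = z (i + q) := by
  constructor
  · intro h i n
    obtain ⟨j, m, hm⟩ := h ⟨i, n, rfl⟩
    have hl := congrArg List.length hm
    rw [length_block, length_block] at hl
    subst hl
    exact ⟨j, block_eq_iff.1 hm.symm⟩
  · rintro h _ ⟨i, n, rfl⟩
    obtain ⟨j, hj⟩ := h i n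
    exact ⟨j, n, block_eq_iff.2 fun q hq => (hj q hq).symm⟩

theorem mem_abClosure_of_language_subset {A : Type*} [DecidableEq A] {u y z : ℕ → A}
    (hy : y ∈ abClosure u) (h : language z ⊆ language y) : z ∈ abClosure u :=
  fun v hv => hy v (h hv)

theorem shift_apply_nat {A : Type*} (g : ℕ) (x : ℕ → A) (n : ℕ) :
    shift g x n = x (g + n) := rfl

theorem setOf_forall_lt_eq_mem_nhds {A : Type*} [TopologicalSpace A] [DiscreteTopology A] (x : ℕ → A)
    (n : ℕ) : {z : ℕ → A | ∀ q < n, z q = x q} ∈ 𝓝 x := by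
  have : {z : ℕ → A | ∀ q < n, z q = x q} = (Set.Iio n).pi fun q => {x q} := by
    ext z; simp [Set.mem_pi]
  rw [this]
  exact set_pi_mem_nhds (Set.finite_Iio n) fun q _ => by simp

/-- The subshift of the words all of whose factors are factors of `y`. -/
def languageSubshift {A : Type*} [TopologicalSpace A] [DiscreteTopology A] (y : ℕ → A) :
    Subshift A ℕ where
  carrier := {z | language z ⊆ language y}
  isClosed := by
    refine isClosed_of_closure_subset fun z hz => language_subset_iff.2 fun i n => ?_
    obtain ⟨x, hxz, hx⟩ := mem_closure_iff_nhds.1 hz _ (setOf_forall_lt_eq_mem_nhds z (i + n))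
    obtain ⟨j, hj⟩ := language_subset_iff.1 hx i n
    exact ⟨j, fun q hq => (hj q hq).trans (hxz (i + q) (by omega))⟩
  mapsTo g z hz := language_subset_iff.2 fun i n => by
    obtain ⟨j, hj⟩ := language_subset_iff.1 hz (g + i) n
    exact ⟨j, fun q hq => by rw [hj q hq, shift_apply_nat, add_assoc]⟩

theorem mem_languageSubshift {A : Type*} [TopologicalSpace A] [DiscreteTopology A] {y z : ℕ → A} :
    z ∈ (languageSubshift y).carrier ↔ language z ⊆ language y := Iff.rfl

/-- Every prefix of `x` starts some shift of `z`, so `x` is a limit of shifts of `z`. -/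
theorem mem_of_language_subset {A : Type*} [TopologicalSpace A] [DiscreteTopology A]
    (Y : Subshift A ℕ) {x z : ℕ → A} (hz : z ∈ Y.carrier) (h : language x ⊆ language z) :
    x ∈ Y.carrier := by
  rw [← Y.isClosed.closure_eq, mem_closure_iff_nhds]
  intro U hU
  rw [nhds_pi, Filter.mem_pi] at hU
  obtain ⟨I, hI, V, hV, hVU⟩ := hU
  obtain ⟨n, hn⟩ := hI.bddAbove
  obtain ⟨j, hj⟩ := language_subset_iff.1 h 0 (n + 1)
  refine ⟨shift j z, hVU fun q hq => ?_, Y.mapsTo j hz⟩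
  have := hj q (Nat.lt_succ_of_le (hn hq))
  rw [zero_add] at this
  rw [shift_apply_nat, this]
  exact mem_of_mem_nhds (hV q)

theorem exists_language_subset_of_common_factor {A : Type*} [Finite A] [DecidableEq A] {u : ℕ → A}
    (haper : IsAperiodic u) (hrec : IsRecurrent u) (hbal : IsBalanced u) :
    ∃ N : ℕ, ∀ y ∈ abClosure u, ∀ z ∈ abClosure u, ∀ i j,
      (∀ q < N, y (i + q) = z (j + q)) → language z ⊆ language y := by
  have := Fintype.ofFinite A
  obtain ⟨α, hα⟩ := exists_isBalancedWith hbal hrec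
  obtain ⟨a, ha⟩ := hα.exists_not_isOfFinAddOrder haper
  obtain ⟨p, hp0, hp⟩ := exists_zsmul_eq_zsmul (fun b => (α b : UnitAddCircle)) a
  have hcom : ∀ b, α b ≠ 0 → Commensurable (α a : UnitAddCircle) (α b) := fun b hb =>
    (hα.commensurable_and_zsmul_height_eq ha hp0 hp hb).1
  obtain ⟨N, hN⟩ := IsBalancedWith.exists_forall_factor_of_common_factor ha
    (fun b hb => (hcom b hb).not_isOfFinAddOrder ha) hp0 (fun b hb => hp b (hcom b hb))
    (fun y hy b hb n => by
      rw [← sub_eq_zero, IsBalancedWith.zsmul_height_sub (hp b (hcom b hb)), sub_eq_zero]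
      exact (hy.commensurable_and_zsmul_height_eq ha hp0 hp hb).2)
  exact ⟨N, fun y hy z hz i j h => language_subset_iff.2
    (hN y z (hα.of_mem_abClosure hy) (hα.of_mem_abClosure hz) i j h)⟩

end AbelianClosure

theorem mainTheorem1 {A : Type*} [Finite A] [DecidableEq A] [TopologicalSpace A]
    [DiscreteTopology A] (u : ℕ → A) (haper : AbelianClosure.IsAperiodic u)
    (hrec : AbelianClosure.IsRecurrent u) (hbal : AbelianClosure.IsBalanced u) :
    ∃ S : Set (Subshift A ℕ), S.Finite ∧ (∀ X ∈ S, AbelianClosure.IsMinimalSubshift X) ∧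
      AbelianClosure.abClosure u = ⋃ X ∈ S, X.carrier := by
  open AbelianClosure in
  obtain ⟨N, hN⟩ := exists_language_subset_of_common_factor haper hrec hbal
  have hlang : ∀ y ∈ abClosure u, ∀ z ∈ abClosure u, ∀ i j,
      (∀ q < N, y (i + q) = z (j + q)) → language y = language z := fun y hy z hz i j h =>
    (hN z hz y hy j i fun q hq => (h q hq).symm).antisymm (hN y hy z hz i j h)
  refine ⟨languageSubshift '' abClosure u, ?_, ?_, ?_⟩
  · refine Set.Finite.of_finite_image (f := fun X => (X.carrier : Set (ℕ → A))) ?_ ?_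
    · rw [Set.image_image]
      -- Equal prefixes of length N give equal languages, so the carrier depends only on that
      -- prefix, which has finitely many values.
      have hfac : ∀ y ∈ abClosure u, (languageSubshift y).carrier =
          {z | ∃ x ∈ abClosure u, (fun q : Fin N => x q) = (fun q : Fin N => y q) ∧
            language z ⊆ language x} := by
        intro y hy
        ext z
        constructor
        · intro hz
          exact ⟨y, hy, rfl, hz⟩
        · rintro ⟨x, hx, hxy, hz⟩
          have := hlang x hx y hy 0 0 fun q hq => by simpa using congrFun hxy ⟨q, hq⟩
          exact mem_languageSubshift.2 (this ▸ hz)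
      refine Set.Finite.subset (Set.finite_range fun w : Fin N → A =>
        {z : ℕ → A | ∃ x ∈ abClosure u, (fun q : Fin N => x q) = w ∧ language z ⊆ language x}) ?_
      rintro _ ⟨y, hy, rfl⟩
      exact ⟨fun q => y q, (hfac y hy).symm⟩
    · rintro ⟨X, _, _⟩ _ ⟨Y, _, _⟩ _ h
      simp only at h
      subst h
      rfl
  · rintro _ ⟨y, hy, rfl⟩
    refine ⟨⟨y, mem_languageSubshift.2 subset_rfl⟩, fun Y hne hsub => hsub.antisymm fun x hx => ?_⟩
    obtain ⟨z, hz⟩ := hne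
    have hzy : language z ⊆ language y := hsub hz
    obtain ⟨j, hj⟩ := language_subset_iff.1 hzy 0 N
    have := hlang y hy z (mem_abClosure_of_language_subset hy hzy) j 0 hj
    exact mem_of_language_subset Y hz (this ▸ hx)
  · ext z
    simp only [Set.mem_iUnion, Set.mem_image, exists_prop, exists_exists_and_eq_and]
    constructor
    · intro hz
      exact ⟨z, hz, mem_languageSubshift.2 subset_rfl⟩
    · rintro ⟨y, hy, hz⟩
      exact mem_abClosure_of_language_subset hy hz
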